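/- A \emph{lattice polygon} is a two-dimensional polytope $P\subset\mathbb{R}^2$ that is the convex hull of finitely many points of $\mathbb{Z}^2$. It is \emph{smooth} if every cone in its normal fan is unimodular, i.e. generated by a subset of a basis of $\mathbb{Z}^2$. Two lattice polygons $P,Q\subset\mathbb{R}^2$ are \emph{integrally equivalent} if there is an affine bijection $\mathbb{R}^2\to\mathbb{R}^2$ that maps $\mathbb{Z}^2$ onto $\mathbb{Z}^2$ and $P$ onto $Q$. \textbf{Theorem.} There are exactly $41$ integral equivalence classes of smooth lattice polygons $P$ with at most $12$ lattice points, i.e. with $|P\cap\mathbb{Z}^2|\le 12$. The number of these classes whose members have exactly $n$ vertices is $3$ for $n=3$, $30$ for $n=4$, $3$ for $n=5$, $4$ for $n=6$, $0$ for $n=7$, $1$ for $n=8$, and $0$ for every $n\ge 9$. -/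

import Mathlib

/-- The inclusion of `ℤ^d` into `ℝ^d`. -/
def intVec {d : ℕ} (z : Fin d → ℤ) : Fin d → ℝ := fun i => (z i : ℝ)

/-- The lattice `ℤ^d`, as a subset of `ℝ^d`. -/
def latticeSet (d : ℕ) : Set (Fin d → ℝ) := Set.range intVec

/-- `P` is a full-dimensional lattice polytope in `ℝ^d`: the convex hull of finitely many points
of `ℤ^d`, with affine span the whole space. For `d = 2` these are the lattice polygons. -/
def IsLatticePolytope {d : ℕ} (P : Set (Fin d → ℝ)) : Prop :=
  (∃ S : Finset (Fin d → ℤ), P = convexHull ℝ (intVec '' (S : Set (Fin d → ℤ)))) ∧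
    affineSpan ℝ P = ⊤

/-- The (inner) normal cone of `P` at a face `F`: the functionals (identified with vectors through
the standard dot product) that attain their minimum over `P` at every point of `F`. At a vertex it
is the dual cone of the tangent cone. -/
def normalCone {d : ℕ} (P F : Set (Fin d → ℝ)) : Set (Fin d → ℝ) :=
  {w | ∀ u ∈ F, ∀ x ∈ P, w ⬝ᵥ u ≤ w ⬝ᵥ x}

/-- The normal fan of `P`: the normal cones at all nonempty faces of `P`. -/
def normalFan {d : ℕ} (P : Set (Fin d → ℝ)) : Set (Set (Fin d → ℝ)) :=
  {σ | ∃ F : Set (Fin d → ℝ), F.Nonempty ∧ IsExposed ℝ P F ∧ σ = normalCone P F}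

/-- A cone is unimodular if it is generated by a subset of a basis of the lattice `ℤ^d` (the members
of that subset are then its primitive minimal generators; for a cone of dimension `d` they form
a lattice basis). -/
def IsUnimodularCone {d : ℕ} (σ : Set (Fin d → ℝ)) : Prop :=
  ∃ (b : Module.Basis (Fin d) ℤ (Fin d → ℤ)) (I : Set (Fin d)),
    σ = (PointedCone.hull ℝ ((fun i => intVec (b i)) '' I) : Set (Fin d → ℝ))

/-- A lattice polytope is smooth if every cone in its normal fan is unimodular. -/
def IsSmoothPolytope {d : ℕ} (P : Set (Fin d → ℝ)) : Prop :=
  ∀ σ ∈ normalFan P, IsUnimodularCone σ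

/-- Integral equivalence of full-dimensional lattice polytopes in `ℝ^d` (so that the affine span of
each of them is `ℝ^d`): an affine bijection of `ℝ^d` maps `ℤ^d` onto `ℤ^d` and `P` onto `Q`. -/
def IntegrallyEquivalent {d : ℕ} (P Q : Set (Fin d → ℝ)) : Prop :=
  ∃ f : (Fin d → ℝ) ≃ᵃ[ℝ] (Fin d → ℝ), f '' latticeSet d = latticeSet d ∧ f '' P = Q

theorem IntegrallyEquivalent.rfl' {d : ℕ} (P : Set (Fin d → ℝ)) : IntegrallyEquivalent P P :=
  ⟨AffineEquiv.refl ℝ _, by simp, by simp⟩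

theorem IntegrallyEquivalent.symm' {d : ℕ} {P Q : Set (Fin d → ℝ)}
    (h : IntegrallyEquivalent P Q) : IntegrallyEquivalent Q P := by
  obtain ⟨f, hL, hP⟩ := h
  have key : ∀ A B : Set (Fin d → ℝ), f '' A = B → f.symm '' B = A := by
    rintro A _ rfl
    rw [Set.image_image]
    simp
  exact ⟨f.symm, key _ _ hL, key _ _ hP⟩

theorem IntegrallyEquivalent.trans' {d : ℕ} {P Q R : Set (Fin d → ℝ)}
    (h : IntegrallyEquivalent P Q) (h' : IntegrallyEquivalent Q R) : IntegrallyEquivalent P R := by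
  obtain ⟨f, hL, rfl⟩ := h
  obtain ⟨g, hL', rfl⟩ := h'
  refine ⟨f.trans g, ?_, ?_⟩
  · rw [AffineEquiv.coe_trans, Set.image_comp, hL, hL']
  · rw [AffineEquiv.coe_trans, Set.image_comp]

/-- Smooth lattice polygons in `ℝ²`. -/
def SmoothPolygon : Type :=
  {P : Set (Fin 2 → ℝ) // IsLatticePolytope P ∧ IsSmoothPolytope P}

instance smoothPolygonSetoid : Setoid SmoothPolygon where
  r P Q := IntegrallyEquivalent P.1 Q.1
  iseqv := ⟨fun P => .rfl' P.1, fun h => h.symm', fun h h' => h.trans' h'⟩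

/-- The number of lattice points of a smooth polygon. -/
noncomputable def SmoothPolygon.numLatticePoints (P : SmoothPolygon) : ℕ∞ :=
  (P.1 ∩ latticeSet 2).encard

/-- The number of vertices of a smooth polygon. -/
noncomputable def SmoothPolygon.numVertices (P : SmoothPolygon) : ℕ∞ :=
  (P.1.extremePoints ℝ).encard

/-- The integral equivalence classes of smooth lattice polygons with at most `N` lattice points. -/
def smoothPolygonClasses (N : ℕ) : Set (Quotient smoothPolygonSetoid) :=
  {c | ∃ P : SmoothPolygon, P.numLatticePoints ≤ N ∧ c = ⟦P⟧}

/-- The integral equivalence classes of smooth lattice polygons with at most `N` lattice points and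
exactly `n` vertices. -/
def smoothPolygonClassesWithVertices (N n : ℕ) : Set (Quotient smoothPolygonSetoid) :=
  {c | ∃ P : SmoothPolygon, P.numLatticePoints ≤ N ∧ P.numVertices = n ∧ c = ⟦P⟧}

/-- The determinant of two vectors of `ℤ²`. -/
def cross (a b : ℤ × ℤ) : ℤ := a.1 * b.2 - a.2 * b.1

/-- A corner of a polygon that is traversed counterclockwise: a vertex, the primitive direction of
the incoming edge, and the primitive direction of the outgoing edge. -/
abbrev Corner : Type := (ℤ × ℤ) × (ℤ × ℤ) × (ℤ × ℤ)

/-- Combinatorial description of a lattice polygon: its lattice points and its corners. -/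
structure PolygonData where
  /-- The lattice points. -/
  pts : List (ℤ × ℤ)
  /-- The corners. -/
  corners : List Corner

/-- Is `x` on the left of the line through `v` in direction `w`, or on it? -/
def isLeft (v w x : ℤ × ℤ) : Bool :=
  match Int.sub (Int.mul w.1 (Int.sub x.2 v.2)) (Int.mul w.2 (Int.sub x.1 v.1)) with
  | .ofNat _ => true
  | .negSucc _ => false

/-- Is `x` on the left of the outgoing edge at each of the corners in `H`? -/
def leftOfAll (H : List Corner) (x : ℤ × ℤ) : Bool :=
  H.all fun c => isLeft c.1 c.2.2 x

/-- A certificate that the lattice points in the positive quadrant that are on the left of all the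
edges in `H` belong to `K`: some corner `c` of `H` maximizes the sum of the coordinates, and all the
points of the triangle that it cuts off are checked. -/
def containsAllLeft (H : List Corner) (K : List (ℤ × ℤ)) : Bool :=
  H.any fun c => decide (cross c.2.1 c.2.2 = 1) && decide (0 ≤ c.2.1.1 + c.2.1.2) &&
    decide (c.2.2.1 + c.2.2.2 ≤ 0) &&
    (List.range ((c.1.1 + c.1.2).toNat + 1)).all fun i =>
      (List.range ((c.1.1 + c.1.2).toNat + 1 - i)).all fun j =>
        !leftOfAll H (.ofNat i, .ofNat j) || decide ((.ofNat i, .ofNat j) ∈ K)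

/-- The coordinates of `x` in the affine frame with origin `v` and unimodular basis `e, f`. -/
def frameCoord (v e f x : ℤ × ℤ) : ℤ × ℤ :=
  (cross e f * cross (x - v) f, cross e f * cross e (x - v))

/-- Does one of the frames given by the corners of `T` carry the lattice points of `T` into the list
`K`, of the same length? -/
def matchesData (K : List (ℤ × ℤ)) (T : PolygonData) : Bool :=
  decide (T.pts.length = K.length) && T.corners.any fun c =>
    (T.pts.all fun x => decide (frameCoord c.1 c.2.2 (-c.2.1) x ∈ K)) ||
    (T.pts.all fun x => decide (frameCoord c.1 (-c.2.1) c.2.2 x ∈ K))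

/-- `forceNat k n` is `k n`, with the small values of `n` evaluated first. -/
def forceNat {α : Type} (k : ℕ → α) : ℕ → α
  | 0 => k 0
  | 1 => k 1
  | 2 => k 2
  | 3 => k 3
  | 4 => k 4
  | 5 => k 5
  | 6 => k 6
  | 7 => k 7
  | 8 => k 8
  | 9 => k 9
  | n => k n

/-- `forceInt k i` is `k i`, with `i` evaluated first. -/
def forceInt {α : Type} (k : ℤ → α) : ℤ → α
  | .ofNat n => forceNat (fun n => k (.ofNat n)) n
  | .negSucc n => forceNat (fun n => k (.negSucc n)) n

/-- `forcePoint k p` is `k p`, with `p` evaluated first. -/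
def forcePoint {α : Type} (k : ℤ × ℤ → α) (p : ℤ × ℤ) : α :=
  forceInt (fun a => forceInt (fun b => k (a, b)) p.2) p.1

/-- Run `k` on all the points `p, p + u, p + 2 • u, …`, adding the points that have been passed to
the list `K`, until that list has more than `12` elements. -/
def scanRow (k : ℤ × ℤ → List (ℤ × ℤ) → Bool) (u : ℤ × ℤ) : ℕ → ℤ × ℤ → List (ℤ × ℤ) → Bool
  | 0, _, _ => false
  | n + 1, p, K => forcePoint (fun p =>
      decide (12 < (K.insert p).length) ||
        (k p (K.insert p) && scanRow k u n (p + u) (K.insert p))) p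

/-- Follow the boundary counterclockwise in all possible ways, from the vertex `v` that has been
reached in direction `u`. Here `H` lists the corners passed so far, `K` lists the lattice points
found so far, and `z` is the first lattice point in the row at distance one from the last edge. The
result is `true` if all polygons with at most `12` lattice points found in this way, up to the
return to the origin, are listed in `table`. -/
def boundarySearch (table : List PolygonData) :
    ℕ → List Corner → List (ℤ × ℤ) → ℤ × ℤ → ℤ × ℤ → ℤ × ℤ → Bool
  | 0, _, _, _, _, _ => false
  | n + 1, H, K, v, u, z =>
    scanRow (fun q K₁ => forcePoint (fun w =>
      !leftOfAll H q || !(K₁.all fun x => isLeft v w x) ||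
      scanRow (fun v' K₂ =>
        !leftOfAll H v' ||
        if v' = 0 then
          containsAllLeft ((v, u, w) :: H) K₂ && table.any fun T => matchesData K₂ T
        else boundarySearch table n ((v, u, w) :: H) K₂ v' w (v - u))
        w 13 q K₁) (q - v)) u 13 z K

/-- The search from the corner at the origin with edges along the coordinate axes. -/
def quadrantSearch (table : List PolygonData) : Bool :=
  scanRow (fun v K =>
    boundarySearch table 13 [(0, (0, -1), (1, 0)), (0, (0, -1), (0, -1))] K v (1, 0) (0, 1))
    (1, 0) 13 (1, 0) [(0, 1), (0, 0)]

/-- Does `T` describe a smooth polygon in the positive quadrant? -/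
def isValidData (T : PolygonData) : Bool :=
  decide T.pts.Nodup && decide ((T.corners.map Prod.fst).Nodup) &&
  (T.pts.all fun x => decide (0 ≤ x.1) && decide (0 ≤ x.2) &&
    ((T.corners.any fun c => decide (c.1 = x)) ||
      T.pts.any fun y => decide (y ≠ x) && decide (2 • x - y ∈ T.pts))) &&
  (T.corners.all fun c => decide (cross c.2.1 c.2.2 = 1) && decide (c.1 ∈ T.pts) &&
    decide (c.1 - c.2.1 ∈ T.pts) && decide (c.1 + c.2.2 ∈ T.pts) &&
    T.pts.all fun x => isLeft c.1 c.2.1 x && isLeft c.1 c.2.2 x) &&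
  decide (T.corners ≠ []) &&
  containsAllLeft T.corners T.pts

/-- The determinant of the scatter matrix of a finite set of lattice points. -/
def scatterDet (L : List (ℤ × ℤ)) : ℤ :=
  (L.length * (L.map fun p => p.1 * p.1).sum - (L.map Prod.fst).sum ^ 2) *
    (L.length * (L.map fun p => p.2 * p.2).sum - (L.map Prod.snd).sum ^ 2) -
  (L.length * (L.map fun p => p.1 * p.2).sum - (L.map Prod.fst).sum * (L.map Prod.snd).sum) ^ 2

/-- The smooth polygons with at most `12` lattice points, up to integral equivalence. -/
def smoothPolygonTable : List PolygonData := [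
  ⟨[(0, 0), (0, 1), (1, 0)],
    [((0, 0), (0, -1), (1, 0)), ((1, 0), (1, 0), (-1, 1)), ((0, 1), (-1, 1), (0, -1))]⟩,
  ⟨[(0, 0), (0, 1), (0, 2), (1, 0), (1, 1), (2, 0)],
    [((0, 0), (0, -1), (1, 0)), ((2, 0), (1, 0), (-1, 1)), ((0, 2), (-1, 1), (0, -1))]⟩,
  ⟨[(0, 0), (0, 1), (0, 2), (0, 3), (1, 0), (1, 1), (1, 2), (2, 0), (2, 1), (3, 0)],
    [((0, 0), (0, -1), (1, 0)), ((3, 0), (1, 0), (-1, 1)), ((0, 3), (-1, 1), (0, -1))]⟩,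
  ⟨[(0, 0), (0, 1), (1, 0), (1, 1)],
    [((0, 0), (0, -1), (1, 0)), ((1, 0), (1, 0), (0, 1)), ((1, 1), (0, 1), (-1, 0)), ((0, 1), (-1,
      0), (0, -1))]⟩,
  ⟨[(0, 0), (0, 1), (0, 2), (1, 0), (1, 1)],
    [((0, 0), (0, -1), (1, 0)), ((1, 0), (1, 0), (0, 1)), ((1, 1), (0, 1), (-1, 1)), ((0, 2), (-1,
      1), (0, -1))]⟩,
  ⟨[(0, 0), (0, 1), (0, 2), (1, 0), (1, 1), (1, 2)],
    [((0, 0), (0, -1), (1, 0)), ((1, 0), (1, 0), (0, 1)), ((1, 2), (0, 1), (-1, 0)), ((0, 2), (-1,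
      0), (0, -1))]⟩,
  ⟨[(0, 0), (0, 1), (0, 2), (0, 3), (1, 0), (1, 1)],
    [((0, 0), (0, -1), (1, 0)), ((1, 0), (1, 0), (0, 1)), ((1, 1), (0, 1), (-1, 2)), ((0, 3), (-1,
      2), (0, -1))]⟩,
  ⟨[(0, 0), (0, 1), (0, 2), (0, 3), (1, 0), (1, 1), (1, 2)],
    [((0, 0), (0, -1), (1, 0)), ((1, 0), (1, 0), (0, 1)), ((1, 2), (0, 1), (-1, 1)), ((0, 3), (-1,
      1), (0, -1))]⟩,
  ⟨[(0, 0), (0, 1), (0, 2), (0, 3), (0, 4), (1, 0), (1, 1)],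
    [((0, 0), (0, -1), (1, 0)), ((1, 0), (1, 0), (0, 1)), ((1, 1), (0, 1), (-1, 3)), ((0, 4), (-1,
      3), (0, -1))]⟩,
  ⟨[(0, 0), (0, 1), (0, 2), (0, 3), (1, 0), (1, 1), (1, 2), (1, 3)],
    [((0, 0), (0, -1), (1, 0)), ((1, 0), (1, 0), (0, 1)), ((1, 3), (0, 1), (-1, 0)), ((0, 3), (-1,
      0), (0, -1))]⟩,
  ⟨[(0, 0), (0, 1), (0, 2), (0, 3), (0, 4), (1, 0), (1, 1), (1, 2)],
    [((0, 0), (0, -1), (1, 0)), ((1, 0), (1, 0), (0, 1)), ((1, 2), (0, 1), (-1, 2)), ((0, 4), (-1,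
      2), (0, -1))]⟩,
  ⟨[(0, 0), (0, 1), (0, 2), (0, 3), (0, 4), (0, 5), (1, 0), (1, 1)],
    [((0, 0), (0, -1), (1, 0)), ((1, 0), (1, 0), (0, 1)), ((1, 1), (0, 1), (-1, 4)), ((0, 5), (-1,
      4), (0, -1))]⟩,
  ⟨[(0, 0), (0, 1), (0, 2), (0, 3), (0, 4), (1, 0), (1, 1), (1, 2), (1, 3)],
    [((0, 0), (0, -1), (1, 0)), ((1, 0), (1, 0), (0, 1)), ((1, 3), (0, 1), (-1, 1)), ((0, 4), (-1,
      1), (0, -1))]⟩,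
  ⟨[(0, 0), (0, 1), (0, 2), (1, 0), (1, 1), (1, 2), (2, 0), (2, 1), (2, 2)],
    [((0, 0), (0, -1), (1, 0)), ((2, 0), (1, 0), (0, 1)), ((2, 2), (0, 1), (-1, 0)), ((0, 2), (-1,
      0), (0, -1))]⟩,
  ⟨[(0, 0), (0, 1), (0, 2), (0, 3), (0, 4), (0, 5), (1, 0), (1, 1), (1, 2)],
    [((0, 0), (0, -1), (1, 0)), ((1, 0), (1, 0), (0, 1)), ((1, 2), (0, 1), (-1, 3)), ((0, 5), (-1,
      3), (0, -1))]⟩,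
  ⟨[(0, 0), (0, 1), (0, 2), (1, 0), (1, 1), (1, 2), (2, 1), (2, 2), (3, 2)],
    [((0, 0), (0, -1), (1, 0)), ((1, 0), (1, 0), (1, 1)), ((3, 2), (1, 1), (-1, 0)), ((0, 2), (-1,
      0), (0, -1))]⟩,
  ⟨[(0, 0), (0, 1), (0, 2), (0, 3), (0, 4), (0, 5), (0, 6), (1, 0), (1, 1)],
    [((0, 0), (0, -1), (1, 0)), ((1, 0), (1, 0), (0, 1)), ((1, 1), (0, 1), (-1, 5)), ((0, 6), (-1,
      5), (0, -1))]⟩,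
  ⟨[(0, 0), (0, 1), (0, 2), (0, 3), (0, 4), (1, 0), (1, 1), (1, 2), (1, 3), (1, 4)],
    [((0, 0), (0, -1), (1, 0)), ((1, 0), (1, 0), (0, 1)), ((1, 4), (0, 1), (-1, 0)), ((0, 4), (-1,
      0), (0, -1))]⟩,
  ⟨[(0, 0), (0, 1), (0, 2), (0, 3), (0, 4), (0, 5), (1, 0), (1, 1), (1, 2), (1, 3)],
    [((0, 0), (0, -1), (1, 0)), ((1, 0), (1, 0), (0, 1)), ((1, 3), (0, 1), (-1, 2)), ((0, 5), (-1,
      2), (0, -1))]⟩,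
  ⟨[(0, 0), (0, 1), (0, 2), (0, 3), (0, 4), (0, 5), (0, 6), (1, 0), (1, 1), (1, 2)],
    [((0, 0), (0, -1), (1, 0)), ((1, 0), (1, 0), (0, 1)), ((1, 2), (0, 1), (-1, 4)), ((0, 6), (-1,
      4), (0, -1))]⟩,
  ⟨[(0, 0), (0, 1), (0, 2), (0, 3), (0, 4), (0, 5), (0, 6), (0, 7), (1, 0), (1, 1)],
    [((0, 0), (0, -1), (1, 0)), ((1, 0), (1, 0), (0, 1)), ((1, 1), (0, 1), (-1, 6)), ((0, 7), (-1,
      6), (0, -1))]⟩,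
  ⟨[(0, 0), (0, 1), (0, 2), (0, 3), (0, 4), (0, 5), (1, 0), (1, 1), (1, 2), (1, 3), (1, 4)],
    [((0, 0), (0, -1), (1, 0)), ((1, 0), (1, 0), (0, 1)), ((1, 4), (0, 1), (-1, 1)), ((0, 5), (-1,
      1), (0, -1))]⟩,
  ⟨[(0, 0), (0, 1), (0, 2), (0, 3), (0, 4), (0, 5), (0, 6), (1, 0), (1, 1), (1, 2), (1, 3)],
    [((0, 0), (0, -1), (1, 0)), ((1, 0), (1, 0), (0, 1)), ((1, 3), (0, 1), (-1, 3)), ((0, 6), (-1,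
      3), (0, -1))]⟩,
  ⟨[(0, 0), (0, 1), (0, 2), (0, 3), (0, 4), (0, 5), (0, 6), (0, 7), (1, 0), (1, 1), (1, 2)],
    [((0, 0), (0, -1), (1, 0)), ((1, 0), (1, 0), (0, 1)), ((1, 2), (0, 1), (-1, 5)), ((0, 7), (-1,
      5), (0, -1))]⟩,
  ⟨[(0, 0), (0, 1), (0, 2), (0, 3), (0, 4), (0, 5), (0, 6), (0, 7), (0, 8), (1, 0), (1, 1)],
    [((0, 0), (0, -1), (1, 0)), ((1, 0), (1, 0), (0, 1)), ((1, 1), (0, 1), (-1, 7)), ((0, 8), (-1,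
      7), (0, -1))]⟩,
  ⟨[(0, 0), (0, 1), (0, 2), (0, 3), (0, 4), (0, 5), (1, 0), (1, 1), (1, 2), (1, 3), (1, 4), (1,
    5)],
    [((0, 0), (0, -1), (1, 0)), ((1, 0), (1, 0), (0, 1)), ((1, 5), (0, 1), (-1, 0)), ((0, 5), (-1,
      0), (0, -1))]⟩,
  ⟨[(0, 0), (0, 1), (0, 2), (0, 3), (0, 4), (0, 5), (0, 6), (1, 0), (1, 1), (1, 2), (1, 3), (1,
    4)],
    [((0, 0), (0, -1), (1, 0)), ((1, 0), (1, 0), (0, 1)), ((1, 4), (0, 1), (-1, 2)), ((0, 6), (-1,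
      2), (0, -1))]⟩,
  ⟨[(0, 0), (0, 1), (0, 2), (0, 3), (1, 0), (1, 1), (1, 2), (1, 3), (2, 0), (2, 1), (2, 2), (2,
    3)],
    [((0, 0), (0, -1), (1, 0)), ((2, 0), (1, 0), (0, 1)), ((2, 3), (0, 1), (-1, 0)), ((0, 3), (-1,
      0), (0, -1))]⟩,
  ⟨[(0, 0), (0, 1), (0, 2), (0, 3), (0, 4), (0, 5), (0, 6), (0, 7), (1, 0), (1, 1), (1, 2), (1,
    3)],
    [((0, 0), (0, -1), (1, 0)), ((1, 0), (1, 0), (0, 1)), ((1, 3), (0, 1), (-1, 4)), ((0, 7), (-1,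
      4), (0, -1))]⟩,
  ⟨[(0, 0), (0, 1), (0, 2), (0, 3), (0, 4), (1, 0), (1, 1), (1, 2), (1, 3), (2, 0), (2, 1), (2,
    2)],
    [((0, 0), (0, -1), (1, 0)), ((2, 0), (1, 0), (0, 1)), ((2, 2), (0, 1), (-1, 1)), ((0, 4), (-1,
      1), (0, -1))]⟩,
  ⟨[(0, 0), (0, 1), (0, 2), (0, 3), (0, 4), (0, 5), (0, 6), (0, 7), (0, 8), (0, 9), (1, 0), (1,
    1)],
    [((0, 0), (0, -1), (1, 0)), ((1, 0), (1, 0), (0, 1)), ((1, 1), (0, 1), (-1, 8)), ((0, 9), (-1,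
      8), (0, -1))]⟩,
  ⟨[(0, 0), (0, 1), (0, 2), (0, 3), (0, 4), (0, 5), (0, 6), (0, 7), (0, 8), (1, 0), (1, 1), (1,
    2)],
    [((0, 0), (0, -1), (1, 0)), ((1, 0), (1, 0), (0, 1)), ((1, 2), (0, 1), (-1, 6)), ((0, 8), (-1,
      6), (0, -1))]⟩,
  ⟨[(0, 0), (0, 1), (0, 2), (1, 0), (1, 1), (1, 2), (2, 1), (2, 2), (3, 1), (3, 2), (4, 2), (5,
    2)],
    [((0, 0), (0, -1), (1, 0)), ((1, 0), (1, 0), (2, 1)), ((5, 2), (2, 1), (-1, 0)), ((0, 2), (-1,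
      0), (0, -1))]⟩,
  ⟨[(0, 0), (0, 1), (0, 2), (1, 0), (1, 1), (1, 2), (2, 1), (2, 2)],
    [((0, 0), (0, -1), (1, 0)), ((1, 0), (1, 0), (1, 1)), ((2, 1), (1, 1), (0, 1)), ((2, 2), (0,
      1), (-1, 0)), ((0, 2), (-1, 0), (0, -1))]⟩,
  ⟨[(0, 0), (0, 1), (0, 2), (0, 3), (1, 0), (1, 1), (1, 2), (1, 3), (2, 1), (2, 2), (2, 3)],
    [((0, 0), (0, -1), (1, 0)), ((1, 0), (1, 0), (1, 1)), ((2, 1), (1, 1), (0, 1)), ((2, 3), (0,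
      1), (-1, 0)), ((0, 3), (-1, 0), (0, -1))]⟩,
  ⟨[(0, 0), (0, 1), (0, 2), (0, 3), (0, 4), (1, 0), (1, 1), (1, 2), (1, 3), (2, 1), (2, 2)],
    [((0, 0), (0, -1), (1, 0)), ((1, 0), (1, 0), (1, 1)), ((2, 1), (1, 1), (0, 1)), ((2, 2), (0,
      1), (-1, 1)), ((0, 4), (-1, 1), (0, -1))]⟩,
  ⟨[(0, 0), (0, 1), (1, 0), (1, 1), (1, 2), (2, 1), (2, 2)],
    [((0, 0), (0, -1), (1, 0)), ((1, 0), (1, 0), (1, 1)), ((2, 1), (1, 1), (0, 1)), ((2, 2), (0,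
      1), (-1, 0)), ((1, 2), (-1, 0), (-1, -1)), ((0, 1), (-1, -1), (0, -1))]⟩,
  ⟨[(0, 0), (0, 1), (0, 2), (1, 0), (1, 1), (1, 2), (1, 3), (2, 1), (2, 2), (2, 3)],
    [((0, 0), (0, -1), (1, 0)), ((1, 0), (1, 0), (1, 1)), ((2, 1), (1, 1), (0, 1)), ((2, 3), (0,
      1), (-1, 0)), ((1, 3), (-1, 0), (-1, -1)), ((0, 2), (-1, -1), (0, -1))]⟩,
  ⟨[(0, 0), (0, 1), (0, 2), (0, 3), (1, 0), (1, 1), (1, 2), (1, 3), (2, 1), (2, 2)],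
    [((0, 0), (0, -1), (1, 0)), ((1, 0), (1, 0), (1, 1)), ((2, 1), (1, 1), (0, 1)), ((2, 2), (0,
      1), (-1, 1)), ((1, 3), (-1, 1), (-1, 0)), ((0, 3), (-1, 0), (0, -1))]⟩,
  ⟨[(0, 0), (0, 1), (0, 2), (1, 0), (1, 1), (1, 2), (1, 3), (2, 1), (2, 2), (2, 3), (3, 2), (3,
    3)],
    [((0, 0), (0, -1), (1, 0)), ((1, 0), (1, 0), (1, 1)), ((3, 2), (1, 1), (0, 1)), ((3, 3), (0,
      1), (-1, 0)), ((1, 3), (-1, 0), (-1, -1)), ((0, 2), (-1, -1), (0, -1))]⟩,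
  ⟨[(0, 0), (0, 1), (1, 0), (1, 1), (1, 2), (1, 3), (2, 1), (2, 2), (2, 3), (2, 4), (3, 3), (3,
    4)],
    [((0, 0), (0, -1), (1, 0)), ((1, 0), (1, 0), (1, 1)), ((2, 1), (1, 1), (1, 2)), ((3, 3), (1,
      2), (0, 1)), ((3, 4), (0, 1), (-1, 0)), ((2, 4), (-1, 0), (-1, -1)), ((1, 3), (-1, -1), (-1,
      -2)), ((0, 1), (-1, -2), (0, -1))]⟩]

theorem quadrantSearch_smoothPolygonTable : quadrantSearch smoothPolygonTable = true := by
  decide +kernel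

theorem isValidData_smoothPolygonTable : smoothPolygonTable.all isValidData = true := by
  decide +kernel

theorem nodup_invariants_smoothPolygonTable :
    (smoothPolygonTable.map fun T => (T.corners.length, scatterDet T.pts)).Nodup := by
  decide +kernel

@[simp] theorem forceNat_eq {α : Type} (k : ℕ → α) (n : ℕ) : forceNat k n = k n := by
  unfold forceNat
  split <;> rfl

@[simp] theorem forceInt_eq {α : Type} (k : ℤ → α) (i : ℤ) : forceInt k i = k i := by
  cases i <;> simp [forceInt]

@[simp] theorem forcePoint_eq {α : Type} (k : ℤ × ℤ → α) (p : ℤ × ℤ) : forcePoint k p = k p := by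
  simp [forcePoint]

theorem fst_nsmul_int (n : ℕ) (u : ℤ × ℤ) : (n • u).1 = n * u.1 := by
  rw [Prod.smul_fst, nsmul_eq_mul]

theorem snd_nsmul_int (n : ℕ) (u : ℤ × ℤ) : (n • u).2 = n * u.2 := by
  rw [Prod.smul_snd, nsmul_eq_mul]

/-- All the points of `S` are on the left of the line through `v` in direction `w`, or on it. -/
def AllLeft (S : Set (ℤ × ℤ)) (v w : ℤ × ℤ) : Prop := ∀ x ∈ S, 0 ≤ cross w (x - v)

theorem isLeft_iff {v w x : ℤ × ℤ} : isLeft v w x = true ↔ 0 ≤ cross w (x - v) := by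
  have h : cross w (x - v) =
      Int.sub (Int.mul w.1 (Int.sub x.2 v.2)) (Int.mul w.2 (Int.sub x.1 v.1)) := rfl
  rw [h, isLeft]
  split <;> rename_i n hn <;> rw [hn] <;> simp

theorem leftOfAll_iff {H : List Corner} {x : ℤ × ℤ} :
    leftOfAll H x = true ↔ ∀ c ∈ H, 0 ≤ cross c.2.2 (x - c.1) := by
  simp [leftOfAll, List.all_eq_true, isLeft_iff]

theorem eq_cross_smul_add {u c : ℤ × ℤ} (h : cross u c = 1) (y : ℤ × ℤ) :
    y = cross y c • u + cross u y • c := by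
  simp only [cross] at *
  ext
  · simp only [Prod.fst_add, Prod.smul_fst, smul_eq_mul]
    linear_combination (-y.1) * h
  · simp only [Prod.snd_add, Prod.smul_snd, smul_eq_mul]
    linear_combination (-y.2) * h

theorem mem_of_containsAllLeft {S : Set (ℤ × ℤ)} {H : List Corner} {K : List (ℤ × ℤ)}
    (hS : ∀ x ∈ S, 0 ≤ x.1 ∧ 0 ≤ x.2)
    (hH : ∀ c ∈ H, AllLeft S c.1 c.2.1 ∧ AllLeft S c.1 c.2.2)
    (h : containsAllLeft H K = true) {x : ℤ × ℤ} (hx : x ∈ S) : x ∈ K := by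
  simp only [containsAllLeft, List.any_eq_true, Bool.and_eq_true, decide_eq_true_eq,
    List.all_eq_true, List.mem_range, Bool.or_eq_true, Bool.not_eq_true'] at h
  obtain ⟨c, hc, ⟨⟨h1, h2⟩, h3⟩, h4⟩ := h
  have hsum : x.1 + x.2 ≤ c.1.1 + c.1.2 := by
    have ha := (hH c hc).1 x hx
    have hb := (hH c hc).2 x hx
    have he := eq_cross_smul_add h1 (x - c.1)
    have e1 := congrArg Prod.fst he
    have e2 := congrArg Prod.snd he
    have hn : cross (x - c.1) c.2.2 ≤ 0 := by
      have : cross (x - c.1) c.2.2 = - cross c.2.2 (x - c.1) := by simp only [cross]; ring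
      omega
    simp only [Prod.fst_sub, Prod.snd_sub, Prod.fst_add, Prod.snd_add, Prod.smul_fst,
      Prod.smul_snd, smul_eq_mul] at e1 e2
    have i1 := mul_nonneg (neg_nonneg.2 hn) h2
    have i2 := mul_nonneg ha (neg_nonneg.2 h3)
    linarith
  obtain ⟨hx1, hx2⟩ := hS x hx
  have h5 := h4 x.1.toNat (by omega) x.2.toNat (by omega)
  have hxe : ((Int.ofNat x.1.toNat, Int.ofNat x.2.toNat) : ℤ × ℤ) = x := by
    ext <;> simp [hx1, hx2]
  rw [hxe] at h5
  rcases h5 with h5 | h5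
  · rw [← Bool.not_eq_true, leftOfAll_iff] at h5
    exact absurd (fun c hc => (hH c hc).2 x hx) h5
  · exact h5

/-- Any list of different elements of `S` has length at most `12`. -/
def AtMostTwelve (S : Set (ℤ × ℤ)) : Prop :=
  ∀ L : List (ℤ × ℤ), L.Nodup → (∀ x ∈ L, x ∈ S) → L.length ≤ 12

theorem exists_of_scanRow {S : Set (ℤ × ℤ)} (hcard : AtMostTwelve S)
    {k : ℤ × ℤ → List (ℤ × ℤ) → Bool} {u : ℤ × ℤ} (n m : ℕ) (p : ℤ × ℤ) (K : List (ℤ × ℤ))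
    (h : scanRow k u n p K = true) (hK : K.Nodup) (hKS : ∀ x ∈ K, x ∈ S)
    (hp : ∀ i ≤ m, p + i • u ∈ S) :
    ∃ K' : List (ℤ × ℤ), K'.Nodup ∧ (∀ x ∈ K', x ∈ S) ∧ k (p + m • u) K' = true := by
  induction n generalizing m p K with
  | zero => simp [scanRow] at h
  | succ n ih =>
    have hK' : (K.insert p).Nodup := List.Nodup.insert hK
    have hKS' : ∀ x ∈ K.insert p, x ∈ S := by
      intro x hx
      rcases (List.mem_insert_iff).1 hx with rfl | hx
      · simpa using hp 0 (Nat.zero_le _)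
      · exact hKS x hx
    have hlen := hcard _ hK' hKS'
    simp only [scanRow, forcePoint_eq, Bool.or_eq_true, decide_eq_true_eq, Bool.and_eq_true,
      Nat.not_lt.2 hlen, false_or] at h
    cases m with
    | zero => exact ⟨_, hK', hKS', by simpa using h.1⟩
    | succ m =>
      have hstep : ∀ i : ℕ, p + u + i • u = p + (i + 1) • u := by
        intro i
        rw [succ_nsmul]
        abel
      obtain ⟨K'', h1, h2, h3⟩ := ih m (p + u) _ h.2 hK' hKS' fun i hi => by
        rw [hstep]
        exact hp _ (by omega)
      exact ⟨K'', h1, h2, by rwa [hstep] at h3⟩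

theorem exists_last_mem {S : Set (ℤ × ℤ)} (hcard : AtMostTwelve S) {p u : ℤ × ℤ} (hu : u ≠ 0)
    (hp : p ∈ S) : ∃ m : ℕ, (∀ i ≤ m, p + i • u ∈ S) ∧ p + (m + 1) • u ∉ S := by
  classical
  have hex : ∃ i : ℕ, p + i • u ∉ S := by
    by_contra! hall
    have hinj : Function.Injective fun i : ℕ => p + i • u := by
      intro i j hij
      have h : i • u = j • u := add_left_cancel hij
      have h1 := congrArg Prod.fst h
      have h2 := congrArg Prod.snd h
      simp only [fst_nsmul_int, snd_nsmul_int, mul_eq_mul_right_iff, Nat.cast_inj] at h1 h2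
      by_contra hne
      exact hu (Prod.ext (h1.resolve_left hne) (h2.resolve_left hne))
    have := hcard ((List.range 13).map fun i => p + i • u) (List.nodup_range.map hinj) (by
      simp only [List.mem_map]
      rintro _ ⟨i, -, rfl⟩
      exact hall i)
    simp at this
  have h0 : Nat.find hex ≠ 0 := fun h => by
    have := Nat.find_spec hex
    rw [h] at this
    exact this (by simpa using hp)
  refine ⟨Nat.find hex - 1, fun i hi => ?_, ?_⟩
  · exact not_not.1 (Nat.find_min hex (by omega))
  · rw [Nat.sub_add_cancel (Nat.one_le_iff_ne_zero.2 h0)]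
    exact Nat.find_spec hex

/-- The lattice points of a segment between two points of `S` belong to `S`. -/
def IsSegmentClosed (S : Set (ℤ × ℤ)) : Prop :=
  ∀ (x u : ℤ × ℤ) (m n : ℕ), m ≤ n → x ∈ S → x + n • u ∈ S → x + m • u ∈ S

/-- At the end of an edge of `S` in the primitive direction `u`, the boundary of `S` turns left into
an edge that forms with the first one a smooth corner. -/
def HasSmoothTurns (S : Set (ℤ × ℤ)) : Prop :=
  ∀ v u z : ℤ × ℤ, cross u z = 1 → v ∈ S → v - u ∈ S → v + u ∉ S → AllLeft S v u →
    ∃ w, cross u w = 1 ∧ v + w ∈ S ∧ AllLeft S v w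

theorem exists_of_boundarySearch {S : Set (ℤ × ℤ)} (hcard : AtMostTwelve S)
    (hseg : IsSegmentClosed S) (hturn : HasSmoothTurns S) (hS : ∀ x ∈ S, 0 ≤ x.1 ∧ 0 ≤ x.2)
    {table : List PolygonData} (n : ℕ) (H : List Corner) (K : List (ℤ × ℤ)) (v u z : ℤ × ℤ)
    (h : boundarySearch table n H K v u z = true)
    (hH : ∀ c ∈ H, AllLeft S c.1 c.2.1 ∧ AllLeft S c.1 c.2.2)
    (hK : K.Nodup) (hKS : ∀ x ∈ K, x ∈ S) (hv : v ∈ S) (hvu : v - u ∈ S) (hvu' : v + u ∉ S)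
    (hu : AllLeft S v u) (hz : z ∈ S) (huz : cross u (z - v) = 1) :
    ∃ K' : List (ℤ × ℤ), K'.Nodup ∧ (∀ x, x ∈ S ↔ x ∈ K') ∧
      ∃ T ∈ table, matchesData K' T = true := by
  induction n generalizing H K v u z with
  | zero => simp [boundarySearch] at h
  | succ n ih =>
    obtain ⟨w, huw, hw, hleft⟩ := hturn v u _ huz hv hvu hvu' hu
    obtain ⟨m, hm⟩ : ∃ m : ℕ, v + w = z + m • u := by
      have h1 := eq_cross_smul_add huz (v + w - z)
      have h2 : cross u (v + w - z) = 0 := by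
        simp only [cross, Prod.fst_add, Prod.snd_add, Prod.fst_sub, Prod.snd_sub] at *
        linarith
      have h3 : cross (v + w - z) (z - v) = cross w (z - v) := by
        simp only [cross, Prod.fst_add, Prod.snd_add, Prod.fst_sub, Prod.snd_sub] at *
        ring
      obtain ⟨m, hm⟩ := Int.eq_ofNat_of_zero_le (hleft z hz)
      refine ⟨m, ?_⟩
      rw [h2, h3, hm, zero_smul, add_zero, natCast_zsmul] at h1
      rw [← h1]
      abel
    rw [boundarySearch] at h
    obtain ⟨K₁, hK₁, hKS₁, h⟩ := exists_of_scanRow hcard 13 m z K h hK hKS fun i hi =>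
      hseg z u i m hi hz (hm ▸ hw)
    rw [← hm, forcePoint_eq, add_sub_cancel_left] at h
    have hl1 : leftOfAll H (v + w) = true := leftOfAll_iff.2 fun c hc => (hH c hc).2 _ hw
    have hl2 : (K₁.all fun x => isLeft v w x) = true :=
      List.all_eq_true.2 fun x hx => isLeft_iff.2 (hleft x (hKS₁ x hx))
    simp only [hl1, hl2, Bool.not_true, Bool.false_or] at h
    have hw0 : w ≠ 0 := by
      rintro rfl
      simp [cross] at huw
    obtain ⟨l, hl, hl'⟩ := exists_last_mem hcard hw0 hw
    obtain ⟨K₂, hK₂, hKS₂, h⟩ := exists_of_scanRow hcard 13 l _ K₁ h hK₁ hKS₁ hl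
    have hv' := hl l le_rfl
    have hl3 : leftOfAll H (v + w + l • w) = true :=
      leftOfAll_iff.2 fun c hc => (hH c hc).2 _ hv'
    have hH' : ∀ c ∈ (v, u, w) :: H, AllLeft S c.1 c.2.1 ∧ AllLeft S c.1 c.2.2 := by
      intro c hc
      rcases List.mem_cons.1 hc with rfl | hc
      · exact ⟨hu, hleft⟩
      · exact hH c hc
    simp only [hl3, Bool.not_true, Bool.false_or] at h
    split at h
    · rw [Bool.and_eq_true, List.any_eq_true] at h
      exact ⟨K₂, hK₂, fun x => ⟨fun hx => mem_of_containsAllLeft hS hH' h.1 hx, hKS₂ x⟩, h.2⟩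
    · refine ih _ _ _ _ _ h hH' hK₂ hKS₂ hv' ?_ ?_ ?_ hvu ?_
      · rcases l with _ | l
        · simpa using hv
        · have := hl l (by omega)
          rwa [show v + w + (l + 1) • w - w = v + w + l • w by rw [succ_nsmul]; abel]
      · rwa [add_assoc, ← succ_nsmul]
      · intro x hx
        have := hleft x hx
        simp only [cross, Prod.fst_add, Prod.snd_add, Prod.fst_sub, Prod.snd_sub,
          fst_nsmul_int, snd_nsmul_int] at *
        linarith
      · simp only [cross, Prod.fst_add, Prod.snd_add, Prod.fst_sub, Prod.snd_sub,
          fst_nsmul_int, snd_nsmul_int] at *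
        linarith

theorem exists_of_quadrantSearch {S : Set (ℤ × ℤ)} (hcard : AtMostTwelve S)
    (hseg : IsSegmentClosed S) (hturn : HasSmoothTurns S) (hS : ∀ x ∈ S, 0 ≤ x.1 ∧ 0 ≤ x.2)
    (h00 : 0 ∈ S) (h10 : (1, 0) ∈ S) (h01 : (0, 1) ∈ S) {table : List PolygonData}
    (h : quadrantSearch table = true) :
    ∃ K' : List (ℤ × ℤ), K'.Nodup ∧ (∀ x, x ∈ S ↔ x ∈ K') ∧
      ∃ T ∈ table, matchesData K' T = true := by
  obtain ⟨l, hl, hl'⟩ := exists_last_mem hcard (u := (1, 0)) (by simp) h10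
  obtain ⟨K, hK, hKS, h⟩ := exists_of_scanRow hcard 13 l _ _ h (by simp) (by
    simp only [List.mem_cons, List.not_mem_nil, or_false]
    rintro x (rfl | rfl)
    · exact h01
    · exact h00) hl
  refine exists_of_boundarySearch hcard hseg hturn hS _ _ _ _ _ _ h ?_ hK hKS (hl l le_rfl) ?_ ?_
    ?_ h01 ?_
  · have h1 : AllLeft S 0 (0, -1) := fun x hx => by
      have := hS x hx
      simp [cross, this]
    have h2 : AllLeft S 0 (1, 0) := fun x hx => by
      have := hS x hx
      simp [cross, this]
    simp only [List.mem_cons, List.not_mem_nil, or_false]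
    rintro c (rfl | rfl)
    · exact ⟨h1, h2⟩
    · exact ⟨h1, h1⟩
  · rcases l with _ | l
    · simpa using h00
    · have := hl l (by omega)
      rwa [succ_nsmul, ← add_assoc, add_sub_cancel_right]
  · rwa [add_assoc, ← succ_nsmul]
  · intro x hx
    have := hS x hx
    simp [cross, this]
  · simp [cross]

/-- `S` has at `v` a smooth corner with edges in directions `e` and `f`. -/
structure IsCornerOf (S : Set (ℤ × ℤ)) (v e f : ℤ × ℤ) : Prop where
  cross_eq : cross e f = 1
  mem : v ∈ S
  add_left_mem : v + e ∈ S
  add_right_mem : v + f ∈ S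
  left_nonneg : ∀ x ∈ S, 0 ≤ cross e (x - v)
  right_nonneg : ∀ x ∈ S, 0 ≤ cross (x - v) f

/-- `S` has a smooth corner at each point that is exposed by an integral functional. -/
def HasSmoothCorners (S : Set (ℤ × ℤ)) : Prop :=
  ∀ v ∈ S, ∀ w : ℤ × ℤ, (∀ x ∈ S, x ≠ v → 0 < w.1 * (x - v).1 + w.2 * (x - v).2) →
    ∃ e f, IsCornerOf S v e f

theorem exists_forall_abs_lt {S : Set (ℤ × ℤ)} (hS : S.Finite) (g : ℤ × ℤ → ℤ) :
    ∃ N : ℤ, 0 < N ∧ ∀ x ∈ S, |g x| < N := by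
  obtain ⟨M, hM⟩ := (hS.image fun x => |g x|).bddAbove
  refine ⟨max M 0 + 1, by positivity, fun x hx => ?_⟩
  have h : |g x| ≤ M := hM (Set.mem_image_of_mem _ hx)
  exact lt_of_le_of_lt (h.trans (le_max_left M 0)) (Int.lt_succ _)

theorem HasSmoothCorners.hasSmoothTurns {S : Set (ℤ × ℤ)} (h : HasSmoothCorners S)
    (hfin : S.Finite) (hseg : IsSegmentClosed S) : HasSmoothTurns S := by
  intro v u z huz hv hvu hvu' hu
  obtain ⟨N, hN0, hN⟩ := exists_forall_abs_lt hfin fun x => cross (x - v) z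
  obtain ⟨e, f, hc⟩ := h v hv (-N * u.2 - z.2, N * u.1 + z.1) (by
    intro x hx hxv
    have h1 : (-N * u.2 - z.2) * (x - v).1 + (N * u.1 + z.1) * (x - v).2 =
        N * cross u (x - v) - cross (x - v) z := by
      simp only [cross]
      ring
    rw [h1]
    have hab := abs_lt.1 (hN x hx)
    rcases (hu x hx).eq_or_lt with h0 | h0
    · have he := eq_cross_smul_add huz (x - v)
      rw [← h0, zero_smul, add_zero] at he
      rw [← h0, mul_zero, zero_sub, Left.neg_pos_iff]
      by_contra! hpos
      obtain ⟨n, hn⟩ := Int.eq_ofNat_of_zero_le hpos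
      rw [hn, natCast_zsmul] at he
      rcases n with _ | n
      · rw [zero_smul] at he
        exact hxv (sub_eq_zero.1 he)
      · have := hseg v u 1 (n + 1) (by omega) hv (by rwa [← he, add_sub_cancel])
        rw [one_smul] at this
        exact hvu' this
    · nlinarith)
  have a1 := hc.right_nonneg _ hvu
  have a2 := hc.left_nonneg _ hvu
  have b1 := hu _ hc.add_left_mem
  have b2 := hu _ hc.add_right_mem
  rw [add_sub_cancel_left] at b1 b2
  have hα : cross u f = 0 := by
    simp only [cross, Prod.fst_sub, Prod.snd_sub] at *
    linarith
  have hef := hc.cross_eq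
  have he := eq_cross_smul_add hef u
  rw [hα, zero_smul, zero_add] at he
  have hn : cross e u * cross f z = 1 := by
    rw [he] at huz
    simp only [cross, Prod.smul_fst, Prod.smul_snd, smul_eq_mul] at *
    linarith
  have hle : cross e u ≤ 0 := by
    simp only [cross] at *
    linarith
  have hm1 : cross e u = -1 := by
    rcases Int.eq_one_or_neg_one_of_mul_eq_one hn with h1 | h1 <;> omega
  refine ⟨e, ?_, hc.add_left_mem, hc.left_nonneg⟩
  simp only [cross] at *
  linarith

theorem HasSmoothCorners.exists_corner {S : Set (ℤ × ℤ)} (h : HasSmoothCorners S)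
    (hfin : S.Finite) (hne : S.Nonempty) : ∃ v e f, IsCornerOf S v e f := by
  obtain ⟨N, hN0, hN⟩ := exists_forall_abs_lt hfin Prod.snd
  obtain ⟨v, hv, hmin⟩ := Set.exists_min_image S (fun x => 2 * N * x.1 + x.2) hfin hne
  refine ⟨v, h v hv (2 * N, 1) fun x hx hxv => ?_⟩
  have h1 := hmin x hx
  have h2 := abs_lt.1 (hN x hx)
  have h3 := abs_lt.1 (hN v hv)
  simp only [Prod.fst_sub, Prod.snd_sub]
  refine lt_of_le_of_ne (by linarith) fun h4 => hxv ?_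
  have h5 : x.1 = v.1 := by
    rcases lt_trichotomy x.1 v.1 with h6 | h6 | h6
    · nlinarith
    · exact h6
    · nlinarith
  refine Prod.ext h5 ?_
  rw [h5] at h4
  linarith

/-- The point with coordinates `q` in the affine frame with origin `v` and basis `e, f`. -/
def framePoint (v e f q : ℤ × ℤ) : ℤ × ℤ := v + (q.1 • e + q.2 • f)

theorem framePoint_frameCoord {v e f : ℤ × ℤ} (h : cross e f ^ 2 = 1) (x : ℤ × ℤ) :
    framePoint v e f (frameCoord v e f x) = x := by
  simp only [framePoint, frameCoord, cross] at *
  ext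
  · simp only [Prod.fst_add, Prod.smul_fst, Prod.fst_sub, Prod.snd_sub, smul_eq_mul]
    linear_combination (x.1 - v.1) * h
  · simp only [Prod.snd_add, Prod.smul_snd, Prod.fst_sub, Prod.snd_sub, smul_eq_mul]
    linear_combination (x.2 - v.2) * h

theorem frameCoord_framePoint {v e f : ℤ × ℤ} (h : cross e f ^ 2 = 1) (q : ℤ × ℤ) :
    frameCoord v e f (framePoint v e f q) = q := by
  simp only [framePoint, frameCoord, cross] at *
  ext
  · simp only [Prod.fst_add, Prod.smul_fst, Prod.fst_sub, Prod.snd_sub, Prod.snd_add,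
      Prod.smul_snd, smul_eq_mul]
    linear_combination q.1 * h
  · simp only [Prod.snd_add, Prod.smul_snd, Prod.fst_sub, Prod.snd_sub, Prod.fst_add,
      Prod.smul_fst, smul_eq_mul]
    linear_combination q.2 * h

theorem framePoint_injective {v e f : ℤ × ℤ} (h : cross e f ^ 2 = 1) :
    Function.Injective (framePoint v e f) :=
  Function.LeftInverse.injective (g := frameCoord v e f) (frameCoord_framePoint h)

theorem framePoint_add (v e f q r : ℤ × ℤ) :
    framePoint v e f (q + r) = framePoint v e f q + framePoint 0 e f r := by
  simp only [framePoint, Prod.fst_add, Prod.snd_add, add_smul]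
  abel

theorem framePoint_sub (v e f q r : ℤ × ℤ) :
    framePoint v e f (q - r) = framePoint v e f q - framePoint 0 e f r := by
  simp only [framePoint, Prod.fst_sub, Prod.snd_sub, sub_smul]
  abel

theorem framePoint_nsmul (e f q : ℤ × ℤ) (n : ℕ) :
    framePoint 0 e f (n • q) = n • framePoint 0 e f q := by
  induction n with
  | zero => simp [framePoint]
  | succ n ih => rw [succ_nsmul, framePoint_add, ih, succ_nsmul]

theorem cross_framePoint {e f : ℤ × ℤ} (h : cross e f = 1) (a b : ℤ × ℤ) :
    cross (framePoint 0 e f a) (framePoint 0 e f b) = cross a b := by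
  simp only [framePoint, cross, zero_add, Prod.fst_add, Prod.smul_fst, Prod.snd_add, Prod.smul_snd,
    smul_eq_mul] at *
  linear_combination (a.1 * b.2 - a.2 * b.1) * h

theorem AtMostTwelve.preimage {S : Set (ℤ × ℤ)} (h : AtMostTwelve S) {φ : ℤ × ℤ → ℤ × ℤ}
    (hφ : Function.Injective φ) : AtMostTwelve (φ ⁻¹' S) := by
  intro L hL hLS
  have := h (L.map φ) (hL.map hφ) (by
    simp only [List.mem_map]
    rintro _ ⟨x, hx, rfl⟩
    exact hLS x hx)
  simpa using this

theorem IsSegmentClosed.preimage_framePoint {S : Set (ℤ × ℤ)} (h : IsSegmentClosed S)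
    (v e f : ℤ × ℤ) : IsSegmentClosed (framePoint v e f ⁻¹' S) := by
  intro x u m n hmn hx hxu
  simp only [Set.mem_preimage, framePoint_add, framePoint_nsmul] at *
  exact h _ _ m n hmn hx hxu

theorem HasSmoothTurns.preimage_framePoint {S : Set (ℤ × ℤ)} (h : HasSmoothTurns S)
    {e f : ℤ × ℤ} (hef : cross e f = 1) (v : ℤ × ℤ) :
    HasSmoothTurns (framePoint v e f ⁻¹' S) := by
  have hef2 : cross e f ^ 2 = 1 := by rw [hef, one_pow]
  intro p u z huz hp hpu hpu' hu
  have key : ∀ x, x - framePoint v e f p =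
      framePoint 0 e f (frameCoord v e f x - p) := fun x => by
    rw [← sub_eq_of_eq_add' (framePoint_add v e f p (frameCoord v e f x - p)),
      add_sub_cancel, framePoint_frameCoord hef2]
  obtain ⟨w, huw, hw, hl⟩ := h (framePoint v e f p) (framePoint 0 e f u) (framePoint 0 e f z)
    (by rw [cross_framePoint hef, huz]) hp (by rwa [← framePoint_sub])
    (by rwa [← framePoint_add]) (by
      intro x hx
      rw [key, cross_framePoint hef]
      exact hu _ (by rwa [Set.mem_preimage, framePoint_frameCoord hef2]))
  have hw' : framePoint 0 e f (frameCoord 0 e f w) = w := framePoint_frameCoord hef2 w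
  refine ⟨frameCoord 0 e f w, ?_, ?_, ?_⟩
  · rw [← cross_framePoint hef, hw', huw]
  · rwa [Set.mem_preimage, framePoint_add, hw']
  · intro x hx
    have := hl _ hx
    rwa [key, frameCoord_framePoint hef2, ← hw', cross_framePoint hef] at this

/-- A smooth set of at most `12` lattice points is, in suitable coordinates, in the table. -/
theorem HasSmoothCorners.exists_matchesData {S : Set (ℤ × ℤ)} (h : HasSmoothCorners S)
    (hfin : S.Finite) (hne : S.Nonempty) (hseg : IsSegmentClosed S) (hcard : AtMostTwelve S) :
    ∃ v e f : ℤ × ℤ, cross e f = 1 ∧ ∃ K : List (ℤ × ℤ), K.Nodup ∧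
      (∀ x, x ∈ framePoint v e f ⁻¹' S ↔ x ∈ K) ∧
      ∃ T ∈ smoothPolygonTable, matchesData K T = true := by
  obtain ⟨v, e, f, hc⟩ := h.exists_corner hfin hne
  have hef := hc.cross_eq
  have hef2 : cross e f ^ 2 = 1 := by rw [hef, one_pow]
  refine ⟨v, e, f, hef, exists_of_quadrantSearch
    (hcard.preimage (framePoint_injective hef2)) (hseg.preimage_framePoint v e f)
    ((h.hasSmoothTurns hfin hseg).preimage_framePoint hef v) ?_ ?_ ?_ ?_
    quadrantSearch_smoothPolygonTable⟩
  · intro x hx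
    have h1 := hc.right_nonneg _ hx
    have h2 := hc.left_nonneg _ hx
    have h3 := frameCoord_framePoint (v := v) hef2 x
    rw [frameCoord, hef, one_mul, one_mul] at h3
    rw [← h3]
    exact ⟨h1, h2⟩
  · simpa [framePoint] using hc.mem
  · simpa [framePoint] using hc.add_left_mem
  · simpa [framePoint] using hc.add_right_mem

/-- The inclusion of `ℤ × ℤ` into `ℝ²`. -/
def intPoint (p : ℤ × ℤ) : Fin 2 → ℝ := ![p.1, p.2]

@[simp] theorem intPoint_zero (p : ℤ × ℤ) : intPoint p 0 = p.1 := rfl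

@[simp] theorem intPoint_one (p : ℤ × ℤ) : intPoint p 1 = p.2 := rfl

theorem intPoint_add (p q : ℤ × ℤ) : intPoint (p + q) = intPoint p + intPoint q := by
  ext i
  fin_cases i <;> simp

theorem intPoint_sub (p q : ℤ × ℤ) : intPoint (p - q) = intPoint p - intPoint q := by
  ext i
  fin_cases i <;> simp

theorem intPoint_nsmul (n : ℕ) (p : ℤ × ℤ) : intPoint (n • p) = (n : ℝ) • intPoint p := by
  ext i
  fin_cases i <;> simp

theorem intPoint_injective : Function.Injective intPoint := fun p q h => by
  have h0 := congrFun h 0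
  have h1 := congrFun h 1
  simp only [intPoint_zero, intPoint_one, Int.cast_inj] at h0 h1
  exact Prod.ext h0 h1

theorem intVec_eq_intPoint (z : Fin 2 → ℤ) : intVec z = intPoint (z 0, z 1) := by
  ext i
  fin_cases i <;> rfl

theorem intPoint_eq_intVec (p : ℤ × ℤ) : intPoint p = intVec ![p.1, p.2] := by
  rw [intVec_eq_intPoint]
  rfl

theorem latticeSet_two : latticeSet 2 = Set.range intPoint := by
  ext x
  constructor
  · rintro ⟨z, rfl⟩
    exact ⟨_, (intVec_eq_intPoint z).symm⟩
  · rintro ⟨p, rfl⟩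
    exact ⟨_, (intPoint_eq_intVec p).symm⟩

/-- The lattice points of a subset of `ℝ²`. -/
def latticePoints (P : Set (Fin 2 → ℝ)) : Set (ℤ × ℤ) := intPoint ⁻¹' P

theorem image_latticePoints (P : Set (Fin 2 → ℝ)) :
    intPoint '' latticePoints P = P ∩ latticeSet 2 := by
  rw [latticePoints, Set.image_preimage_eq_inter_range, latticeSet_two]

theorem encard_latticePoints (P : Set (Fin 2 → ℝ)) :
    (latticePoints P).encard = (P ∩ latticeSet 2).encard := by
  rw [← image_latticePoints, intPoint_injective.encard_image]

theorem IsLatticePolytope.convexHull_latticePoints {P : Set (Fin 2 → ℝ)}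
    (h : IsLatticePolytope P) : convexHull ℝ (intPoint '' latticePoints P) = P := by
  obtain ⟨⟨S, rfl⟩, -⟩ := h
  apply Set.Subset.antisymm
  · refine convexHull_min ?_ (convex_convexHull ℝ _)
    rintro _ ⟨p, hp, rfl⟩
    exact hp
  · apply convexHull_mono
    rintro _ ⟨z, hz, rfl⟩
    refine ⟨(z 0, z 1), ?_, (intVec_eq_intPoint z).symm⟩
    rw [latticePoints, Set.mem_preimage, ← intVec_eq_intPoint]
    exact subset_convexHull ℝ _ ⟨z, hz, rfl⟩

theorem IsLatticePolytope.isBounded {P : Set (Fin 2 → ℝ)} (h : IsLatticePolytope P) :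
    Bornology.IsBounded P := by
  obtain ⟨⟨S, rfl⟩, -⟩ := h
  exact isBounded_convexHull.2 (S.finite_toSet.image _).isBounded

theorem IsLatticePolytope.convex {P : Set (Fin 2 → ℝ)} (h : IsLatticePolytope P) :
    Convex ℝ P := by
  obtain ⟨⟨S, rfl⟩, -⟩ := h
  exact convex_convexHull ℝ _

theorem IsLatticePolytope.finite_latticePoints {P : Set (Fin 2 → ℝ)} (h : IsLatticePolytope P) :
    (latticePoints P).Finite := by
  obtain ⟨R, hR⟩ := h.isBounded.exists_norm_le
  have key : ∀ (n : ℤ), |(n : ℝ)| ≤ R → n ∈ Set.Icc (-⌈R⌉) ⌈R⌉ := fun n hn => by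
    have h1 := abs_le.1 (hn.trans (Int.le_ceil R))
    exact ⟨by exact_mod_cast h1.1, by exact_mod_cast h1.2⟩
  refine ((Set.finite_Icc (-⌈R⌉) ⌈R⌉).prod (Set.finite_Icc (-⌈R⌉) ⌈R⌉)).subset fun p hp => ?_
  have hp' := hR _ hp
  exact ⟨key _ ((norm_le_pi_norm (intPoint p) 0).trans hp'),
    key _ ((norm_le_pi_norm (intPoint p) 1).trans hp')⟩

theorem IsLatticePolytope.nonempty_latticePoints {P : Set (Fin 2 → ℝ)}
    (h : IsLatticePolytope P) : (latticePoints P).Nonempty := by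
  by_contra hne
  rw [Set.not_nonempty_iff_eq_empty] at hne
  have hP := h.convexHull_latticePoints
  rw [hne, Set.image_empty, convexHull_empty] at hP
  have := h.2
  rw [← hP, AffineSubspace.span_empty] at this
  exact AffineSubspace.bot_ne_top ℝ (Fin 2 → ℝ) (Fin 2 → ℝ) this

theorem IsLatticePolytope.isSegmentClosed {P : Set (Fin 2 → ℝ)} (h : IsLatticePolytope P) :
    IsSegmentClosed (latticePoints P) := by
  intro x u m n hmn hx hxu
  rcases Nat.eq_zero_or_pos n with rfl | hn
  · rwa [Nat.le_zero.1 hmn]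
  simp only [latticePoints, Set.mem_preimage, intPoint_add, intPoint_nsmul] at *
  have hn' : (0 : ℝ) < n := Nat.cast_pos.2 hn
  have := h.convex.add_smul_mem hx hxu (t := (m : ℝ) / n)
    ⟨by positivity, (div_le_one hn').2 (Nat.cast_le.2 hmn)⟩
  rwa [smul_smul, div_mul_cancel₀ _ hn'.ne'] at this

/-- The standard scalar product on `ℤ²`. -/
def dotInt (a b : ℤ × ℤ) : ℤ := a.1 * b.1 + a.2 * b.2

theorem dotProduct_intPoint (w : Fin 2 → ℝ) (b : ℤ × ℤ) :
    w ⬝ᵥ intPoint b = w 0 * b.1 + w 1 * b.2 := by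
  simp [dotProduct, Fin.sum_univ_two]

theorem intPoint_dotProduct_intPoint (a b : ℤ × ℤ) :
    intPoint a ⬝ᵥ intPoint b = (dotInt a b : ℝ) := by
  simp [dotInt]

theorem convex_setOf_le_dotProduct (w : Fin 2 → ℝ) (c : ℝ) : Convex ℝ {x | c ≤ w ⬝ᵥ x} :=
  convex_halfSpace_ge ⟨fun x y => dotProduct_add w x y, fun a x => dotProduct_smul a w x⟩ c

theorem mem_normalCone_singleton_iff {S : Set (ℤ × ℤ)} {v : ℤ × ℤ} {w : Fin 2 → ℝ} :
    w ∈ normalCone (convexHull ℝ (intPoint '' S)) {intPoint v} ↔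
      ∀ x ∈ S, 0 ≤ w ⬝ᵥ intPoint (x - v) := by
  simp only [intPoint_sub, dotProduct_sub, sub_nonneg]
  constructor
  · intro h x hx
    exact h _ rfl _ (subset_convexHull ℝ _ ⟨x, hx, rfl⟩)
  · rintro h _ rfl x hx
    refine convexHull_min ?_ (convex_setOf_le_dotProduct w (w ⬝ᵥ intPoint v)) hx
    rintro _ ⟨y, hy, rfl⟩
    exact h y hy

theorem isExposed_singleton {S : Set (ℤ × ℤ)} {v : ℤ × ℤ} (hv : v ∈ S) {w : Fin 2 → ℝ}
    (h : ∀ x ∈ S, x ≠ v → 0 < w ⬝ᵥ intPoint (x - v)) :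
    IsExposed ℝ (convexHull ℝ (intPoint '' S)) {intPoint v} := by
  simp only [intPoint_sub, dotProduct_sub, sub_pos] at h
  have hsub : convexHull ℝ (intPoint '' S) ⊆
      {x | x = intPoint v ∨ w ⬝ᵥ intPoint v < w ⬝ᵥ x} := by
    refine convexHull_min ?_ ?_
    · rintro _ ⟨x, hx, rfl⟩
      by_cases hxv : x = v
      · exact Or.inl (by rw [hxv])
      · exact Or.inr (h x hx hxv)
    · intro x hx y hy a b ha hb hab
      have hle : ∀ z, (z = intPoint v ∨ w ⬝ᵥ intPoint v < w ⬝ᵥ z) →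
          w ⬝ᵥ intPoint v ≤ w ⬝ᵥ z := by
        rintro z (rfl | hz)
        · exact le_rfl
        · exact hz.le
      rcases ha.eq_or_lt with rfl | ha
      · rw [zero_add] at hab
        simpa [hab] using hy
      rcases hb.eq_or_lt with rfl | hb
      · rw [add_zero] at hab
        simpa [hab] using hx
      simp only [Set.mem_ofPred_eq, dotProduct_add, dotProduct_smul, smul_eq_mul]
      have hx' := hle x hx
      have hy' := hle y hy
      rcases hx with rfl | hx
      · rcases hy with rfl | hy
        · left
          rw [← add_smul, hab, one_smul]
        · right
          nlinarith [mul_pos hb (sub_pos.2 hy), congrArg (· * w ⬝ᵥ intPoint v) hab]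
      · right
        nlinarith [mul_pos ha (sub_pos.2 hx), mul_nonneg hb.le (sub_nonneg.2 hy'),
          congrArg (· * w ⬝ᵥ intPoint v) hab]
  have hvP : intPoint v ∈ convexHull ℝ (intPoint '' S) := subset_convexHull ℝ _ ⟨v, hv, rfl⟩
  have happ : ∀ x, (-LinearMap.toContinuousLinearMap (dotProductEquiv ℝ (Fin 2) w)) x
      = -(w ⬝ᵥ x) := fun x => rfl
  intro _
  refine ⟨-LinearMap.toContinuousLinearMap (dotProductEquiv ℝ (Fin 2) w), ?_⟩
  ext x
  simp only [Set.mem_singleton_iff, Set.mem_ofPred_eq, happ, neg_le_neg_iff]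
  constructor
  · rintro rfl
    refine ⟨hvP, fun y hy => ?_⟩
    rcases hsub hy with rfl | hy
    · exact le_rfl
    · exact hy.le
  · rintro ⟨hx, hmin⟩
    exact (hsub hx).resolve_right (not_lt.2 (hmin _ hvP))

/-- Suppose that the integral functionals that attain their minimum over `S` at `v` are generated by
`β` (if `I` holds) and `γ` (if `J` holds), that one of them attains it only at `v`, and that `d` is
the vector dual to `β` in the basis `β, γ`. Then `β` is needed, and if `γ` is a generator too, `v`
has a neighbour in `S` in direction `d`. -/
theorem generator_and_add_mem {S : Set (ℤ × ℤ)} (hfin : S.Finite) (hseg : IsSegmentClosed S)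
    {v : ℤ × ℤ} (hv : v ∈ S) {w₀ : ℤ × ℤ} (hw₀ : ∀ x ∈ S, x ≠ v → 0 < dotInt w₀ (x - v))
    {β γ d : ℤ × ℤ} {I J : Prop} (hJ : J → ∀ x ∈ S, 0 ≤ dotInt γ (x - v))
    (hgen : ∀ a e : ℤ × ℤ, (∀ x ∈ S, 0 ≤ dotInt a (x - v)) → (I → 0 ≤ dotInt β e) →
      (J → 0 ≤ dotInt γ e) → 0 ≤ dotInt a e)
    (hβd : dotInt β d = 1) (hγd : dotInt γ d = 0)
    (hdual : ∀ y, dotInt γ y = 0 → y = dotInt β y • d) :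
    I ∧ (I → (∀ x ∈ S, 0 ≤ dotInt β (x - v)) → J → v + d ∈ S) := by
  constructor
  · by_contra hI
    obtain ⟨N, hN0, hN⟩ := exists_forall_abs_lt hfin fun x => dotInt d (x - v)
    have h1 : ∀ e, dotInt γ e = 0 → 0 ≤ dotInt w₀ e := fun e he =>
      hgen w₀ e (fun x hx => by
        by_cases hxv : x = v
        · simp [hxv, dotInt]
        · exact (hw₀ x hx hxv).le) (fun h => absurd h hI) fun _ => he.ge
    have h2 : dotInt w₀ d = 0 := by
      have ha := h1 d hγd
      have hb := h1 (-d) (by simp only [dotInt, Prod.fst_neg, Prod.snd_neg] at *; linarith)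
      simp only [dotInt, Prod.fst_neg, Prod.snd_neg] at *
      linarith
    have h3 := hgen (N * w₀.1 - d.1, N * w₀.2 - d.2) d (fun x hx => by
      have he : dotInt (N * w₀.1 - d.1, N * w₀.2 - d.2) (x - v) =
          N * dotInt w₀ (x - v) - dotInt d (x - v) := by
        simp only [dotInt]
        ring
      rw [he]
      by_cases hxv : x = v
      · simp [hxv, dotInt]
      · have := hw₀ x hx hxv
        have := abs_lt.1 (hN x hx)
        nlinarith) (fun h => absurd h hI) fun _ => hγd.ge
    have h4 : dotInt (N * w₀.1 - d.1, N * w₀.2 - d.2) d =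
        N * dotInt w₀ d - (d.1 ^ 2 + d.2 ^ 2) := by
      simp only [dotInt]
      ring
    rw [h4, h2, mul_zero, zero_sub, Left.nonneg_neg_iff] at h3
    have h5 : d.1 = 0 := by nlinarith [sq_nonneg d.1, sq_nonneg d.2]
    have h6 : d.2 = 0 := by nlinarith [sq_nonneg d.1, sq_nonneg d.2]
    simp [dotInt, h5, h6] at hβd
  · intro _ hβ hj
    have hγ := hJ hj
    by_contra hnot
    obtain ⟨N, hN0, hN⟩ := exists_forall_abs_lt hfin fun x => dotInt β (x - v)
    have h3 := hgen (N * γ.1 - β.1, N * γ.2 - β.2) d (fun x hx => by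
      have he : dotInt (N * γ.1 - β.1, N * γ.2 - β.2) (x - v) =
          N * dotInt γ (x - v) - dotInt β (x - v) := by
        simp only [dotInt]
        ring
      rw [he]
      have hab := abs_lt.1 (hN x hx)
      rcases (hγ x hx).eq_or_lt with h0 | h0
      · have hd := hdual _ h0.symm
        obtain ⟨n, hn⟩ := Int.eq_ofNat_of_zero_le (hβ x hx)
        rw [← h0, hn]
        rcases n with _ | n
        · simp
        · rw [hn, natCast_zsmul] at hd
          have := hseg v d 1 (n + 1) (by omega) hv (by rwa [← hd, add_sub_cancel])
          rw [one_smul] at this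
          exact absurd this hnot
      · nlinarith) (fun _ => by rw [hβd]; exact zero_le_one) fun _ => hγd.ge
    have h4 : dotInt (N * γ.1 - β.1, N * γ.2 - β.2) d = N * dotInt γ d - dotInt β d := by
      simp only [dotInt]
      ring
    rw [h4, hγd, hβd, mul_zero, zero_sub] at h3
    omega

theorem exists_isCornerOf_of_generators {S : Set (ℤ × ℤ)} (hfin : S.Finite)
    (hseg : IsSegmentClosed S) {v : ℤ × ℤ} (hv : v ∈ S) {w₀ : ℤ × ℤ}
    (hw₀ : ∀ x ∈ S, x ≠ v → 0 < dotInt w₀ (x - v)) {β γ : ℤ × ℤ} {I J : Prop}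
    (hβγ : cross β γ = 1)
    (hI : I → ∀ x ∈ S, 0 ≤ dotInt β (x - v)) (hJ : J → ∀ x ∈ S, 0 ≤ dotInt γ (x - v))
    (hgen : ∀ a e : ℤ × ℤ, (∀ x ∈ S, 0 ≤ dotInt a (x - v)) → (I → 0 ≤ dotInt β e) →
      (J → 0 ≤ dotInt γ e) → 0 ≤ dotInt a e) :
    ∃ e f, IsCornerOf S v e f := by
  obtain ⟨hi, h1⟩ := generator_and_add_mem hfin hseg hv hw₀ (d := (γ.2, -γ.1)) hJ hgen
    (by simp only [cross, dotInt] at *; linarith) (by simp only [dotInt]; ring) (by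
      intro y hy
      simp only [cross, dotInt] at *
      ext <;> simp only [Prod.smul_fst, Prod.smul_snd, smul_eq_mul]
      · linear_combination (-y.1) * hβγ - β.2 * hy
      · linear_combination (-y.2) * hβγ + β.1 * hy)
  obtain ⟨hj, h2⟩ := generator_and_add_mem hfin hseg hv hw₀ (d := (-β.2, β.1)) hI
    (fun a e ha hj hi => hgen a e ha hi hj)
    (by simp only [cross, dotInt] at *; linarith) (by simp only [dotInt]; ring) (by
      intro y hy
      simp only [cross, dotInt] at *
      ext <;> simp only [Prod.smul_fst, Prod.smul_snd, smul_eq_mul]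
      · linear_combination (-y.1) * hβγ + γ.2 * hy
      · linear_combination (-y.2) * hβγ - γ.1 * hy)
  refine ⟨(γ.2, -γ.1), (-β.2, β.1), ?_, hv, h1 hi (hI hi) hj, h2 hj (hJ hj) hi, ?_, ?_⟩
  · simp only [cross] at *
    linarith
  · intro x hx
    have := hJ hj x hx
    simp only [cross, dotInt] at *
    linarith
  · intro x hx
    have := hI hi x hx
    simp only [cross, dotInt] at *
    linarith

theorem cross_basis (b : Module.Basis (Fin 2) ℤ (Fin 2 → ℤ)) :
    cross (b 0 0, b 0 1) (b 1 0, b 1 1) = 1 ∨ cross (b 0 0, b 0 1) (b 1 0, b 1 1) = -1 := by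
  have h1 := b.sum_repr ![1, 0]
  have h2 := b.sum_repr ![0, 1]
  rw [Fin.sum_univ_two] at h1 h2
  have h10 := congrFun h1 0
  have h11 := congrFun h1 1
  have h20 := congrFun h2 0
  have h21 := congrFun h2 1
  simp only [Pi.add_apply, Pi.smul_apply, smul_eq_mul, Matrix.cons_val_zero, Matrix.cons_val_one]
    at h10 h11 h20 h21
  refine Int.eq_one_or_neg_one_of_mul_eq_one (v := b.repr ![1, 0] 0 * b.repr ![0, 1] 1 -
    b.repr ![1, 0] 1 * b.repr ![0, 1] 0) ?_
  simp only [cross]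
  set p := b.repr ![1, 0] 0
  set q := b.repr ![1, 0] 1
  set r := b.repr ![0, 1] 0
  set s := b.repr ![0, 1] 1
  calc _ = (p * b 0 0 + q * b 1 0) * (r * b 0 1 + s * b 1 1) -
        (p * b 0 1 + q * b 1 1) * (r * b 0 0 + s * b 1 0) := by ring
    _ = 1 := by rw [h10, h11, h20, h21]; norm_num

theorem IsSmoothPolytope.hasSmoothCorners {P : Set (Fin 2 → ℝ)} (hP : IsLatticePolytope P)
    (h : IsSmoothPolytope P) : HasSmoothCorners (latticePoints P) := by
  intro v hv w₀ hw₀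
  have hconv := hP.convexHull_latticePoints
  set S := latticePoints P with hS
  have hmem : ∀ a : ℤ × ℤ, intPoint a ∈ normalCone P {intPoint v} ↔
      ∀ x ∈ S, 0 ≤ dotInt a (x - v) := by
    intro a
    rw [← hconv, mem_normalCone_singleton_iff]
    simp only [intPoint_dotProduct_intPoint, Int.cast_nonneg_iff]
  have hexp : IsExposed ℝ P {intPoint v} := by
    rw [← hconv]
    refine isExposed_singleton hv (w := intPoint w₀) fun x hx hxv => ?_
    rw [intPoint_dotProduct_intPoint, Int.cast_pos]
    exact hw₀ x hx hxv
  obtain ⟨b, I, hσ⟩ := h _ ⟨_, Set.singleton_nonempty _, hexp, rfl⟩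
  have hI : ∀ i, i ∈ I → ∀ x ∈ S, 0 ≤ dotInt (b i 0, b i 1) (x - v) := by
    intro i hi
    rw [← hmem, hσ, ← intVec_eq_intPoint]
    exact PointedCone.subset_hull ⟨i, hi, rfl⟩
  have hgen : ∀ a e : ℤ × ℤ, (∀ x ∈ S, 0 ≤ dotInt a (x - v)) →
      (∀ i, i ∈ I → 0 ≤ dotInt (b i 0, b i 1) e) → 0 ≤ dotInt a e := by
    intro a e ha he
    have ha' := (hmem a).2 ha
    rw [hσ] at ha'
    have key : ∀ w ∈ PointedCone.hull ℝ ((fun i => intVec (b i)) '' I),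
        0 ≤ w ⬝ᵥ intPoint e := by
      intro w hw
      induction hw using Submodule.span_induction with
      | mem w hw =>
        obtain ⟨i, hi, rfl⟩ := hw
        change 0 ≤ intVec (b i) ⬝ᵥ intPoint e
        rw [intVec_eq_intPoint, intPoint_dotProduct_intPoint, Int.cast_nonneg_iff]
        exact he i hi
      | zero => rw [zero_dotProduct]
      | add w₁ w₂ _ _ h₁ h₂ =>
        rw [add_dotProduct]
        exact add_nonneg h₁ h₂
      | smul c w _ hw =>
        rw [show c • w = (c : ℝ) • w from rfl, smul_dotProduct]
        exact mul_nonneg c.2 hw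
    have := key _ ha'
    rwa [intPoint_dotProduct_intPoint, Int.cast_nonneg_iff] at this
  have hfin := hP.finite_latticePoints
  have hseg := hP.isSegmentClosed
  rcases cross_basis b with hb | hb
  · exact exists_isCornerOf_of_generators hfin hseg hv hw₀ hb (hI 0) (hI 1) fun a e ha h0 h1 =>
      hgen a e ha fun i => by fin_cases i <;> assumption
  · refine exists_isCornerOf_of_generators hfin hseg hv hw₀ (β := (b 1 0, b 1 1))
      (γ := (b 0 0, b 0 1)) ?_ (hI 1) (hI 0) fun a e ha h0 h1 =>
        hgen a e ha fun i => by fin_cases i <;> assumption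
    simp only [cross] at *
    linarith

/-- The properties that `isValidData` checks. -/
structure PolygonData.IsValid (T : PolygonData) : Prop where
  nodup_pts : T.pts.Nodup
  nodup_vertices : (T.corners.map Prod.fst).Nodup
  nonneg : ∀ x ∈ T.pts, 0 ≤ x.1 ∧ 0 ≤ x.2
  vertex_or_midpoint : ∀ x ∈ T.pts,
    (∃ c ∈ T.corners, c.1 = x) ∨ ∃ y ∈ T.pts, y ≠ x ∧ 2 • x - y ∈ T.pts
  cross_eq : ∀ c ∈ T.corners, cross c.2.1 c.2.2 = 1
  vertex_mem : ∀ c ∈ T.corners, c.1 ∈ T.pts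
  sub_mem : ∀ c ∈ T.corners, c.1 - c.2.1 ∈ T.pts
  add_mem : ∀ c ∈ T.corners, c.1 + c.2.2 ∈ T.pts
  left_in : ∀ c ∈ T.corners, ∀ x ∈ T.pts, 0 ≤ cross c.2.1 (x - c.1)
  left_out : ∀ c ∈ T.corners, ∀ x ∈ T.pts, 0 ≤ cross c.2.2 (x - c.1)
  corners_ne_nil : T.corners ≠ []
  contains : containsAllLeft T.corners T.pts = true

theorem isValid_of_isValidData {T : PolygonData} (h : isValidData T = true) : T.IsValid := by
  simp only [isValidData, Bool.and_eq_true, Bool.or_eq_true, decide_eq_true_eq, List.all_eq_true,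
    List.any_eq_true, isLeft_iff] at h
  obtain ⟨⟨⟨⟨⟨h1, h2⟩, h3⟩, h4⟩, h5⟩, h6⟩ := h
  exact ⟨h1, h2, fun x hx => (h3 x hx).1, fun x hx => (h3 x hx).2, fun c hc => (h4 c hc).1.1.1.1,
    fun c hc => (h4 c hc).1.1.1.2, fun c hc => (h4 c hc).1.1.2, fun c hc => (h4 c hc).1.2,
    fun c hc x hx => ((h4 c hc).2 x hx).1, fun c hc x hx => ((h4 c hc).2 x hx).2, h5, h6⟩

/-- The polygon described by `T`. -/
def PolygonData.toSet (T : PolygonData) : Set (Fin 2 → ℝ) :=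
  convexHull ℝ (intPoint '' {x | x ∈ T.pts})

theorem dotInt_nonneg_of_mem_convexHull {A : Set (ℤ × ℤ)} {a v : ℤ × ℤ}
    (h : ∀ x ∈ A, 0 ≤ dotInt a (x - v)) {y : Fin 2 → ℝ} (hy : y ∈ convexHull ℝ (intPoint '' A)) :
    0 ≤ intPoint a ⬝ᵥ (y - intPoint v) := by
  rw [dotProduct_sub, sub_nonneg]
  refine (mem_normalCone_singleton_iff (S := A)).2 (fun x hx => ?_) _ rfl _ hy
  rw [intPoint_dotProduct_intPoint, Int.cast_nonneg_iff]
  exact h x hx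

/-- The vector `a` turned left by a right angle. -/
def turnLeft (a : ℤ × ℤ) : ℤ × ℤ := (-a.2, a.1)

theorem dotInt_turnLeft (a b : ℤ × ℤ) : dotInt (turnLeft a) b = cross a b := by
  simp only [dotInt, turnLeft, cross]
  ring

namespace PolygonData.IsValid

variable {T : PolygonData}

theorem subset_toSet (T : PolygonData) {x : ℤ × ℤ} (hx : x ∈ T.pts) : intPoint x ∈ T.toSet :=
  subset_convexHull ℝ _ ⟨x, hx, rfl⟩

theorem left_in_toSet (h : T.IsValid) {c : Corner} (hc : c ∈ T.corners) {y : Fin 2 → ℝ}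
    (hy : y ∈ T.toSet) : 0 ≤ intPoint (turnLeft c.2.1) ⬝ᵥ (y - intPoint c.1) :=
  dotInt_nonneg_of_mem_convexHull
    (fun x hx => (dotInt_turnLeft c.2.1 (x - c.1)).symm ▸ h.left_in c hc x hx) hy

theorem left_out_toSet (h : T.IsValid) {c : Corner} (hc : c ∈ T.corners) {y : Fin 2 → ℝ}
    (hy : y ∈ T.toSet) : 0 ≤ intPoint (turnLeft c.2.2) ⬝ᵥ (y - intPoint c.1) :=
  dotInt_nonneg_of_mem_convexHull
    (fun x hx => (dotInt_turnLeft c.2.2 (x - c.1)).symm ▸ h.left_out c hc x hx) hy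

theorem latticePoints_toSet (h : T.IsValid) : latticePoints T.toSet = {x | x ∈ T.pts} := by
  apply Set.Subset.antisymm
  · intro x hx
    refine mem_of_containsAllLeft (S := latticePoints T.toSet) ?_ ?_ h.contains hx
    · intro y hy
      have h1 := dotInt_nonneg_of_mem_convexHull (a := (1, 0)) (v := 0)
        (fun x hx => by simpa [dotInt] using (h.nonneg x hx).1) hy
      have h2 := dotInt_nonneg_of_mem_convexHull (a := (0, 1)) (v := 0)
        (fun x hx => by simpa [dotInt] using (h.nonneg x hx).2) hy
      rw [← intPoint_sub, intPoint_dotProduct_intPoint, Int.cast_nonneg_iff] at h1 h2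
      simpa [dotInt] using And.intro h1 h2
    · intro c hc
      constructor
      · intro y hy
        have := h.left_in_toSet hc hy
        rwa [← intPoint_sub, intPoint_dotProduct_intPoint, Int.cast_nonneg_iff,
          dotInt_turnLeft] at this
      · intro y hy
        have := h.left_out_toSet hc hy
        rwa [← intPoint_sub, intPoint_dotProduct_intPoint, Int.cast_nonneg_iff,
          dotInt_turnLeft] at this
  · intro x hx
    exact subset_toSet T hx

theorem eq_add_of_corner (h : T.IsValid) {c : Corner} (hc : c ∈ T.corners) (w : Fin 2 → ℝ) :
    w = (w ⬝ᵥ intPoint c.2.2) • intPoint (turnLeft c.2.1) +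
      (w ⬝ᵥ intPoint (-c.2.1)) • intPoint (turnLeft c.2.2) := by
  have h1 := h.cross_eq c hc
  have h2 : (c.2.1.1 : ℝ) * c.2.2.2 - c.2.1.2 * c.2.2.1 = 1 := by exact_mod_cast h1
  ext i
  fin_cases i
  · simp [turnLeft]
    linear_combination (-w 0) * h2
  · simp [turnLeft]
    linear_combination (-w 1) * h2

theorem isLatticePolytope (h : T.IsValid) : IsLatticePolytope T.toSet := by
  constructor
  · refine ⟨(T.pts.map fun p => ![p.1, p.2]).toFinset, ?_⟩
    rw [PolygonData.toSet]
    congr 1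
    ext y
    simp [intPoint_eq_intVec]
  · obtain ⟨c, hc⟩ := List.exists_mem_of_ne_nil _ h.corners_ne_nil
    have hv := subset_affineSpan ℝ _ (subset_toSet T (h.vertex_mem c hc))
    have hu := subset_affineSpan ℝ _ (subset_toSet T (h.sub_mem c hc))
    have hw := subset_affineSpan ℝ _ (subset_toSet T (h.add_mem c hc))
    have du := AffineSubspace.vsub_mem_direction hu hv
    have dw := AffineSubspace.vsub_mem_direction hw hv
    rw [vsub_eq_sub, ← intPoint_sub] at du dw
    rw [sub_sub_cancel_left] at du
    rw [add_sub_cancel_left] at dw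
    rw [eq_top_iff]
    intro x _
    have h2 : (c.2.1.1 : ℝ) * c.2.2.2 - c.2.1.2 * c.2.2.1 = 1 := by
      exact_mod_cast h.cross_eq c hc
    have hx : x = (((x - intPoint c.1) ⬝ᵥ intPoint (turnLeft c.2.2)) • intPoint (-c.2.1) +
        ((x - intPoint c.1) ⬝ᵥ intPoint (turnLeft c.2.1)) • intPoint c.2.2) +ᵥ intPoint c.1 := by
      ext i
      fin_cases i
      · simp [turnLeft]
        linear_combination (c.1.1 - x 0) * h2
      · simp [turnLeft]
        linear_combination (c.1.2 - x 1) * h2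
    rw [hx]
    exact AffineSubspace.vadd_mem_of_mem_direction
      (Submodule.add_mem _ (Submodule.smul_mem _ _ du) (Submodule.smul_mem _ _ dw)) hv

theorem extremePoints_toSet (h : T.IsValid) :
    T.toSet.extremePoints ℝ = intPoint '' {x | x ∈ T.corners.map Prod.fst} := by
  apply Set.Subset.antisymm
  · intro y hy
    obtain ⟨x, hx, rfl⟩ := extremePoints_convexHull_subset hy
    refine ⟨x, ?_, rfl⟩
    rcases h.vertex_or_midpoint x hx with ⟨c, hc, rfl⟩ | ⟨z, hz, hzx, hz'⟩
    · exact List.mem_map_of_mem hc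
    · exfalso
      apply hzx
      apply intPoint_injective
      refine hy.2 (subset_toSet T hz) (subset_toSet T hz')
        ⟨1 / 2, 1 / 2, by norm_num, by norm_num, by norm_num, ?_⟩
      ext i
      fin_cases i
      · simp
        ring
      · simp
        ring
  · rintro _ ⟨x, hx, rfl⟩
    obtain ⟨c, hc, rfl⟩ := List.mem_map.1 hx
    have hexp := isExposed_singleton (S := {x | x ∈ T.pts}) (h.vertex_mem c hc)
      (w := intPoint (turnLeft c.2.1 + turnLeft c.2.2)) fun x hx hxv => by
        rw [intPoint_dotProduct_intPoint, Int.cast_pos]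
        have h1 := h.left_in c hc x hx
        have h2 := h.left_out c hc x hx
        have h3 : dotInt (turnLeft c.2.1 + turnLeft c.2.2) (x - c.1) =
            cross c.2.1 (x - c.1) + cross c.2.2 (x - c.1) := by
          simp only [dotInt, turnLeft, cross, Prod.fst_add, Prod.snd_add]
          ring
        rw [h3]
        by_contra hle
        have h4 : cross c.2.1 (x - c.1) = 0 := by omega
        have h5 : cross (x - c.1) c.2.2 = 0 := by
          have : cross c.2.2 (x - c.1) = 0 := by omega
          simp only [cross] at *
          linarith
        have h6 := eq_cross_smul_add (h.cross_eq c hc) (x - c.1)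
        rw [h4, h5, zero_smul, zero_smul, add_zero] at h6
        exact hxv (sub_eq_zero.1 h6)
    exact isExtreme_singleton.1 hexp.isExtreme

end PolygonData.IsValid

/-- The basis of `ℤ²` formed by two vectors of determinant one. -/
noncomputable def basisOfCross (p q : ℤ × ℤ) (h : cross p q = 1) :
    Module.Basis (Fin 2) ℤ (Fin 2 → ℤ) :=
  .ofEquivFun
    { toFun := fun x => ![x 0 * q.2 - x 1 * q.1, p.1 * x 1 - p.2 * x 0]
      map_add' := fun x y => by
        ext i
        fin_cases i <;> simp <;> ring
      map_smul' := fun a x => by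
        ext i
        fin_cases i <;> simp <;> ring
      invFun := fun y => ![y 0 * p.1 + y 1 * q.1, y 0 * p.2 + y 1 * q.2]
      left_inv := fun x => by
        rw [cross] at h
        ext i
        fin_cases i
        · simp
          linear_combination (x 0) * h
        · simp
          linear_combination (x 1) * h
      right_inv := fun y => by
        rw [cross] at h
        ext i
        fin_cases i
        · simp
          linear_combination (y 0) * h
        · simp
          linear_combination (y 1) * h }

theorem intVec_basisOfCross (p q : ℤ × ℤ) (h : cross p q = 1) (i : Fin 2) :
    intVec (basisOfCross p q h i) = intPoint (![p, q] i) := by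
  rw [intVec_eq_intPoint]
  fin_cases i <;> simp [basisOfCross]

theorem PolygonData.IsValid.isSmoothPolytope {T : PolygonData} (h : T.IsValid) :
    IsSmoothPolytope T.toSet := by
  rintro _ ⟨F, hF, hexp, rfl⟩
  have hcomp : IsCompact T.toSet :=
    Set.Finite.isCompact_convexHull ℝ ((List.finite_toSet T.pts).image intPoint)
  obtain ⟨y, hy⟩ := (hexp.isCompact hcomp).extremePoints_nonempty hF
  have hy' := hexp.isExtreme.extremePoints_subset_extremePoints hy
  rw [h.extremePoints_toSet] at hy'
  obtain ⟨x, hx, rfl⟩ := hy'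
  obtain ⟨c, hc, rfl⟩ := List.mem_map.1 hx
  have hvF : intPoint c.1 ∈ F := hy.1
  have hFP : F ⊆ T.toSet := hexp.subset
  have hdet : cross (turnLeft c.2.1) (turnLeft c.2.2) = 1 := by
    rw [← h.cross_eq c hc]
    simp only [cross, turnLeft]
    ring
  refine ⟨basisOfCross _ _ hdet,
    {i | ∀ x ∈ F, intPoint (![turnLeft c.2.1, turnLeft c.2.2] i) ⬝ᵥ (x - intPoint c.1) = 0}, ?_⟩
  simp only [intVec_basisOfCross]
  have hnn : ∀ (i : Fin 2), ∀ x ∈ T.toSet,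
      0 ≤ intPoint (![turnLeft c.2.1, turnLeft c.2.2] i) ⬝ᵥ (x - intPoint c.1) := by
    intro i x hx
    fin_cases i
    · exact h.left_in_toSet hc hx
    · exact h.left_out_toSet hc hx
  apply Set.Subset.antisymm
  · intro w hw
    have ha : 0 ≤ w ⬝ᵥ intPoint c.2.2 := by
      have := hw _ hvF _ (PolygonData.IsValid.subset_toSet T (h.add_mem c hc))
      rwa [intPoint_add, dotProduct_add, le_add_iff_nonneg_right] at this
    have hb : 0 ≤ w ⬝ᵥ intPoint (-c.2.1) := by
      have := hw _ hvF _ (PolygonData.IsValid.subset_toSet T (h.sub_mem c hc))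
      rwa [sub_eq_add_neg, intPoint_add, dotProduct_add, le_add_iff_nonneg_right] at this
    have hdec := h.eq_add_of_corner hc w
    set α := w ⬝ᵥ intPoint c.2.2
    set β := w ⬝ᵥ intPoint (-c.2.1)
    have hzero : ∀ x ∈ F, α * (intPoint (turnLeft c.2.1) ⬝ᵥ (x - intPoint c.1)) +
        β * (intPoint (turnLeft c.2.2) ⬝ᵥ (x - intPoint c.1)) = 0 := by
      intro x hx
      have h1 := hw _ hvF _ (hFP hx)
      have h2 := hw _ hx _ (hFP hvF)
      have h3 : w ⬝ᵥ (x - intPoint c.1) = 0 := by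
        rw [dotProduct_sub]
        linarith
      rwa [hdec, add_dotProduct, smul_dotProduct, smul_dotProduct, smul_eq_mul, smul_eq_mul] at h3
    rw [hdec]
    have key : ∀ (i : Fin 2) (t : ℝ), 0 ≤ t →
        (∀ x ∈ F, t * (intPoint (![turnLeft c.2.1, turnLeft c.2.2] i) ⬝ᵥ (x - intPoint c.1)) = 0) →
        t • intPoint (![turnLeft c.2.1, turnLeft c.2.2] i) ∈ PointedCone.hull ℝ
          ((fun i => intPoint (![turnLeft c.2.1, turnLeft c.2.2] i)) ''
          {i | ∀ x ∈ F,
            intPoint (![turnLeft c.2.1, turnLeft c.2.2] i) ⬝ᵥ (x - intPoint c.1) = 0}) := by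
      intro i t ht hi
      rcases ht.eq_or_lt with rfl | ht'
      · rw [zero_smul]
        exact Submodule.zero_mem _
      · refine Submodule.smul_mem _ (⟨t, ht⟩ : {c : ℝ // 0 ≤ c})
          (PointedCone.subset_hull ⟨i, ?_, rfl⟩)
        intro x hx
        exact (mul_eq_zero.1 (hi x hx)).resolve_left ht'.ne'
    refine Submodule.add_mem _ (key 0 α ha fun x hx => ?_) (key 1 β hb fun x hx => ?_)
    · have h1 := mul_nonneg ha (hnn 0 x (hFP hx))
      have h2 := mul_nonneg hb (hnn 1 x (hFP hx))
      exact le_antisymm ((le_add_of_nonneg_right h2).trans (hzero x hx).le) h1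
    · have h1 := mul_nonneg ha (hnn 0 x (hFP hx))
      have h2 := mul_nonneg hb (hnn 1 x (hFP hx))
      exact le_antisymm ((le_add_of_nonneg_left h1).trans (hzero x hx).le) h2
  · intro w hw u hu x hx
    induction hw using Submodule.span_induction with
    | mem w hw =>
      obtain ⟨i, hi, rfl⟩ := hw
      have h1 := hi u hu
      have h2 := hnn i x hx
      rw [dotProduct_sub] at h1 h2
      linarith
    | zero => rw [zero_dotProduct, zero_dotProduct]
    | add w₁ w₂ _ _ h₁ h₂ =>
      rw [add_dotProduct, add_dotProduct]
      exact add_le_add h₁ h₂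
    | smul t w _ hw =>
      rw [show t • w = (t : ℝ) • w from rfl, smul_dotProduct, smul_dotProduct]
      exact mul_le_mul_of_nonneg_left hw t.2

theorem intPoint_framePoint (v e f x : ℤ × ℤ) : intPoint (framePoint v e f x) =
    (x.1 : ℝ) • intPoint e + (x.2 : ℝ) • intPoint f + intPoint v := by
  ext i
  fin_cases i <;> simp [framePoint] <;> ring

/-- The linear automorphism of `ℝ²` with columns `e` and `f`, of determinant `±1`. -/
noncomputable def frameLinearEquiv (e f : ℤ × ℤ) (h : cross e f ^ 2 = 1) :
    (Fin 2 → ℝ) ≃ₗ[ℝ] (Fin 2 → ℝ) :=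
  have h' : ((e.1 : ℝ) * f.2 - e.2 * f.1) ^ 2 = 1 := by exact_mod_cast h
  { toFun := fun x => x 0 • intPoint e + x 1 • intPoint f
    map_add' := fun x y => by
      simp only [Pi.add_apply, add_smul]
      abel
    map_smul' := fun a x => by
      simp only [Pi.smul_apply, smul_eq_mul, mul_smul, smul_add, RingHom.id_apply]
    invFun := fun y => ![(cross e f : ℝ) * (y 0 * f.2 - y 1 * f.1),
      (cross e f : ℝ) * (e.1 * y 1 - e.2 * y 0)]
    left_inv := fun x => by
      ext i
      fin_cases i
      · simp [cross]
        linear_combination (x 0) * h'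
      · simp [cross]
        linear_combination (x 1) * h'
    right_inv := fun y => by
      ext i
      fin_cases i
      · simp [cross]
        linear_combination (y 0) * h'
      · simp [cross]
        linear_combination (y 1) * h' }

theorem integrallyEquivalent_image_framePoint {v e f : ℤ × ℤ} (h : cross e f ^ 2 = 1)
    (S : Set (ℤ × ℤ)) : IntegrallyEquivalent (convexHull ℝ (intPoint '' S))
      (convexHull ℝ (intPoint '' (framePoint v e f '' S))) := by
  set g : (Fin 2 → ℝ) ≃ᵃ[ℝ] (Fin 2 → ℝ) :=
    (frameLinearEquiv e f h).toAffineEquiv.trans (AffineEquiv.constVAdd ℝ _ (intPoint v)) with hg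
  have happ : ∀ x, g (intPoint x) = intPoint (framePoint v e f x) := fun x => by
    rw [intPoint_framePoint, add_comm]
    rfl
  refine ⟨g, ?_, ?_⟩
  · rw [latticeSet_two, ← Set.range_comp]
    ext y
    constructor
    · rintro ⟨x, rfl⟩
      exact ⟨_, (happ x).symm⟩
    · rintro ⟨x, rfl⟩
      exact ⟨frameCoord v e f x, by rw [Function.comp_apply, happ, framePoint_frameCoord h]⟩
  · have := g.toAffineMap.image_convexHull (intPoint '' S)
    rw [AffineEquiv.coe_toAffineMap] at this
    rw [this, Set.image_image, Set.image_image]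
    simp only [happ]

theorem exists_framePoint_of_image_latticeSet {g : (Fin 2 → ℝ) ≃ᵃ[ℝ] (Fin 2 → ℝ)}
    (h : g '' latticeSet 2 = latticeSet 2) : ∃ v e f : ℤ × ℤ, cross e f ^ 2 = 1 ∧
      ∀ x, g (intPoint x) = intPoint (framePoint v e f x) := by
  rw [latticeSet_two] at h
  have hint : ∀ x, ∃ y, intPoint y = g (intPoint x) := fun x => by
    have : g (intPoint x) ∈ g '' Set.range intPoint := ⟨_, ⟨x, rfl⟩, rfl⟩
    rwa [h] at this
  obtain ⟨v, hv⟩ := hint 0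
  obtain ⟨p, hp⟩ := hint (1, 0)
  obtain ⟨q, hq⟩ := hint (0, 1)
  have hdec : ∀ x, g x = g.linear x + g (intPoint 0) := fun x => by
    have h0 : intPoint 0 = 0 := by
      ext i
      fin_cases i <;> simp
    have := g.map_vadd 0 x
    rwa [vadd_eq_add, vadd_eq_add, add_zero, ← h0] at this
  have happ : ∀ x, g (intPoint x) = intPoint (framePoint v (p - v) (q - v) x) := by
    intro x
    have hx : intPoint x = (x.1 : ℝ) • intPoint (1, 0) + (x.2 : ℝ) • intPoint (0, 1) := by
      ext i
      fin_cases i <;> simp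
    rw [intPoint_framePoint, intPoint_sub, intPoint_sub, hv, hp, hq, hdec (intPoint (1, 0)),
      hdec (intPoint (0, 1)), add_sub_cancel_right, add_sub_cancel_right, hdec (intPoint x)]
    conv_lhs => rw [hx, map_add, map_smul, map_smul]
  refine ⟨v, p - v, q - v, ?_, happ⟩
  have hsurj : ∀ y, ∃ x, framePoint v (p - v) (q - v) x = y := fun y => by
    have : intPoint y ∈ g '' Set.range intPoint := by
      rw [h]
      exact ⟨y, rfl⟩
    obtain ⟨_, ⟨x, rfl⟩, hx⟩ := this
    exact ⟨x, intPoint_injective (by rw [← happ, hx])⟩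
  obtain ⟨a, ha⟩ := hsurj (v + (1, 0))
  obtain ⟨b, hb⟩ := hsurj (v + (0, 1))
  have ha1 := congrArg Prod.fst (add_left_cancel ha)
  have ha2 := congrArg Prod.snd (add_left_cancel ha)
  have hb1 := congrArg Prod.fst (add_left_cancel hb)
  have hb2 := congrArg Prod.snd (add_left_cancel hb)
  generalize p - v = e at *
  generalize q - v = f at *
  simp only [Prod.fst_add, Prod.snd_add, Prod.smul_fst, Prod.smul_snd, smul_eq_mul]
    at ha1 ha2 hb1 hb2
  have hmul : cross e f * cross a b = 1 := by
    simp only [cross]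
    calc _ = (a.1 * e.1 + a.2 * f.1) * (b.1 * e.2 + b.2 * f.2) -
          (a.1 * e.2 + a.2 * f.2) * (b.1 * e.1 + b.2 * f.1) := by ring
      _ = 1 := by rw [ha1, ha2, hb1, hb2]; norm_num
  rcases Int.eq_one_or_neg_one_of_mul_eq_one hmul with h1 | h1 <;> rw [h1] <;> norm_num

theorem encard_extremePoints_image_le (g : (Fin 2 → ℝ) ≃ᵃ[ℝ] (Fin 2 → ℝ))
    (P : Set (Fin 2 → ℝ)) :
    ((g '' P).extremePoints ℝ).encard ≤ (P.extremePoints ℝ).encard := by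
  refine (Set.encard_le_encard (t := g '' P.extremePoints ℝ) ?_).trans (Set.encard_image_le _ _)
  rintro _ ⟨⟨x, hx, rfl⟩, hy⟩
  refine ⟨x, ⟨hx, fun a ha b hb hab => g.injective ?_⟩, rfl⟩
  refine hy ⟨a, ha, rfl⟩ ⟨b, hb, rfl⟩ ?_
  have := image_openSegment ℝ g.toAffineMap a b
  rw [AffineEquiv.coe_toAffineMap] at this
  rw [← this]
  exact ⟨x, hab, rfl⟩

theorem IntegrallyEquivalent.encard_extremePoints_eq {P Q : Set (Fin 2 → ℝ)}
    (h : IntegrallyEquivalent P Q) :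
    (P.extremePoints ℝ).encard = (Q.extremePoints ℝ).encard := by
  apply le_antisymm
  · obtain ⟨g, -, rfl⟩ := h.symm'
    exact encard_extremePoints_image_le g Q
  · obtain ⟨g, -, rfl⟩ := h
    exact encard_extremePoints_image_le g P

theorem scatterDet_map_framePoint {v e f : ℤ × ℤ} (h : cross e f ^ 2 = 1) (L : List (ℤ × ℤ)) :
    scatterDet (L.map (framePoint v e f)) = scatterDet L := by
  have h1 : ((L.map (framePoint v e f)).map Prod.fst).sum =
      v.1 * L.length + e.1 * (L.map Prod.fst).sum + f.1 * (L.map Prod.snd).sum := by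
    induction L with
    | nil => simp
    | cons x L ih =>
      simp only [List.map_cons, List.sum_cons, ih, List.length_cons, framePoint, Prod.fst_add,
        Prod.smul_fst, smul_eq_mul, Nat.cast_add, Nat.cast_one]
      ring
  have h2 : ((L.map (framePoint v e f)).map Prod.snd).sum =
      v.2 * L.length + e.2 * (L.map Prod.fst).sum + f.2 * (L.map Prod.snd).sum := by
    clear h1
    induction L with
    | nil => simp
    | cons x L ih =>
      simp only [List.map_cons, List.sum_cons, ih, List.length_cons, framePoint, Prod.snd_add,
        Prod.smul_snd, smul_eq_mul, Nat.cast_add, Nat.cast_one]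
      ring
  have key : ∀ (α α₁ α₂ β β₁ β₂ : ℤ),
      (L.map fun x => (α + (x.1 * α₁ + x.2 * α₂)) * (β + (x.1 * β₁ + x.2 * β₂))).sum =
      α * β * L.length + (α * β₁ + β * α₁) * (L.map Prod.fst).sum +
      (α * β₂ + β * α₂) * (L.map Prod.snd).sum + α₁ * β₁ * (L.map fun p => p.1 * p.1).sum +
      α₂ * β₂ * (L.map fun p => p.2 * p.2).sum +
      (α₁ * β₂ + α₂ * β₁) * (L.map fun p => p.1 * p.2).sum := by
    intro α α₁ α₂ β β₁ β₂
    clear h1 h2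
    induction L with
    | nil => simp
    | cons x L ih =>
      simp only [List.map_cons, List.sum_cons, ih, List.length_cons, Nat.cast_add, Nat.cast_one]
      ring
  rw [scatterDet, h1, h2, scatterDet]
  simp only [List.map_map, List.length_map, Function.comp_def, framePoint, Prod.fst_add,
    Prod.snd_add, Prod.smul_fst, Prod.smul_snd, smul_eq_mul, key]
  rw [cross] at h
  generalize (L.map fun p => p.1 * p.1).sum = A
  generalize (L.map fun p => p.1 * p.2).sum = B
  generalize (L.map fun p => p.2 * p.2).sum = C
  generalize (L.map Prod.fst).sum = X
  generalize (L.map Prod.snd).sum = Y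
  linear_combination ((L.length * A - X ^ 2) * (L.length * C - Y ^ 2) -
    (L.length * B - X * Y) ^ 2) * h

theorem scatterDet_perm {L M : List (ℤ × ℤ)} (h : L.Perm M) : scatterDet L = scatterDet M := by
  simp only [scatterDet, h.length_eq, (h.map _).sum_eq]

theorem IntegrallyEquivalent.scatterDet_eq {T T' : PolygonData} (hT : T.IsValid)
    (hT' : T'.IsValid) (h : IntegrallyEquivalent T.toSet T'.toSet) :
    scatterDet T.pts = scatterDet T'.pts := by
  obtain ⟨g, hg, hP⟩ := h
  obtain ⟨v, e, f, hef, happ⟩ := exists_framePoint_of_image_latticeSet hg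
  rw [← scatterDet_map_framePoint (v := v) hef]
  apply scatterDet_perm
  rw [List.perm_ext_iff_of_nodup (hT.nodup_pts.map (framePoint_injective hef)) hT'.nodup_pts]
  have h1 : ∀ x, x ∈ T'.pts ↔ intPoint x ∈ T'.toSet := fun x =>
    (Set.ext_iff.1 hT'.latticePoints_toSet x).symm
  have h2 : ∀ x, x ∈ T.pts ↔ intPoint x ∈ T.toSet := fun x =>
    (Set.ext_iff.1 hT.latticePoints_toSet x).symm
  intro y
  rw [h1, ← hP, List.mem_map]
  constructor
  · rintro ⟨x, hx, rfl⟩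
    exact ⟨intPoint x, (h2 x).1 hx, happ x⟩
  · rintro ⟨z, hz, hzy⟩
    have hx : intPoint (frameCoord v e f y) = z := g.injective (by
      rw [happ, framePoint_frameCoord hef, hzy])
    exact ⟨frameCoord v e f y, (h2 _).2 (hx ▸ hz), framePoint_frameCoord hef y⟩

theorem exists_framePoint_of_matchesData {K : List (ℤ × ℤ)} {T : PolygonData} (hT : T.IsValid)
    (h : matchesData K T = true) : ∃ v e f : ℤ × ℤ, cross e f ^ 2 = 1 ∧
      {x | x ∈ T.pts} = framePoint v e f '' {x | x ∈ K} := by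
  have key : ∀ v e f : ℤ × ℤ, cross e f ^ 2 = 1 → T.pts.length = K.length →
      (∀ x ∈ T.pts, frameCoord v e f x ∈ K) →
      {x | x ∈ T.pts} = framePoint v e f '' {x | x ∈ K} := by
    intro v e f hef hlen hall
    have hinj : Function.Injective (frameCoord v e f) :=
      Function.LeftInverse.injective (g := framePoint v e f) (framePoint_frameCoord hef)
    have hperm : (T.pts.map (frameCoord v e f)).Perm K :=
      (List.subperm_of_subset (hT.nodup_pts.map hinj) (fun y hy => by
        obtain ⟨x, hx, rfl⟩ := List.mem_map.1 hy
        exact hall x hx)).perm_of_length_le (by rw [List.length_map, hlen])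
    ext x
    constructor
    · intro hx
      exact ⟨_, hall x hx, framePoint_frameCoord hef x⟩
    · rintro ⟨y, hy, rfl⟩
      obtain ⟨x, hx, rfl⟩ := List.mem_map.1 (hperm.mem_iff.2 hy)
      rwa [framePoint_frameCoord hef]
  simp only [matchesData, Bool.and_eq_true, Bool.or_eq_true, decide_eq_true_eq, List.all_eq_true,
    List.any_eq_true] at h
  obtain ⟨hlen, c, hc, h | h⟩ := h
  · have hef : cross c.2.2 (-c.2.1) ^ 2 = 1 := by
      rw [show cross c.2.2 (-c.2.1) = cross c.2.1 c.2.2 by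
        simp only [cross, Prod.fst_neg, Prod.snd_neg]; ring, hT.cross_eq c hc, one_pow]
    exact ⟨_, _, _, hef, key _ _ _ hef hlen h⟩
  · have hef : cross (-c.2.1) c.2.2 ^ 2 = 1 := by
      rw [show cross (-c.2.1) c.2.2 = -cross c.2.1 c.2.2 by
        simp only [cross, Prod.fst_neg, Prod.snd_neg]; ring, hT.cross_eq c hc]
      norm_num
    exact ⟨_, _, _, hef, key _ _ _ hef hlen h⟩

theorem isValid_of_mem_smoothPolygonTable {T : PolygonData} (hT : T ∈ smoothPolygonTable) :
    T.IsValid :=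
  isValid_of_isValidData (List.all_eq_true.1 isValidData_smoothPolygonTable T hT)

theorem exists_integrallyEquivalent_of_encard_le {P : Set (Fin 2 → ℝ)}
    (hP : IsLatticePolytope P) (hsm : IsSmoothPolytope P)
    (hcard : (P ∩ latticeSet 2).encard ≤ 12) :
    ∃ T ∈ smoothPolygonTable, IntegrallyEquivalent P T.toSet := by
  rw [← encard_latticePoints] at hcard
  obtain ⟨v, e, f, hef, K, hK, hKS, T, hT, hm⟩ :=
    (hsm.hasSmoothCorners hP).exists_matchesData hP.finite_latticePoints
      hP.nonempty_latticePoints hP.isSegmentClosed (by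
        intro L hL hLS
        have h1 : ((L.toFinset : Set (ℤ × ℤ))).encard ≤ 12 :=
          (Set.encard_le_encard fun x hx => hLS x (List.mem_toFinset.1 hx)).trans hcard
        rw [Set.encard_coe_eq_coe_finsetCard, List.toFinset_card_of_nodup hL] at h1
        exact_mod_cast h1)
  have hef2 : cross e f ^ 2 = 1 := by rw [hef, one_pow]
  refine ⟨T, hT, ?_⟩
  obtain ⟨v', e', f', hef', hT'⟩ :=
    exists_framePoint_of_matchesData (isValid_of_mem_smoothPolygonTable hT) hm
  have hS : latticePoints P = framePoint v e f '' {x | x ∈ K} := by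
    ext x
    constructor
    · intro hx
      refine ⟨frameCoord v e f x, (hKS _).1 ?_, framePoint_frameCoord hef2 x⟩
      rwa [Set.mem_preimage, framePoint_frameCoord hef2]
    · rintro ⟨y, hy, rfl⟩
      exact (hKS y).2 hy
  rw [← hP.convexHull_latticePoints, hS, PolygonData.toSet, hT']
  exact (integrallyEquivalent_image_framePoint hef2 _).symm'.trans'
    (integrallyEquivalent_image_framePoint hef' _)

/-- The `i`-th smooth polygon of the table. -/
noncomputable def tablePolygon (i : Fin smoothPolygonTable.length) : SmoothPolygon :=
  ⟨(smoothPolygonTable.get i).toSet,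
    (isValid_of_mem_smoothPolygonTable (List.get_mem _ i)).isLatticePolytope,
    (isValid_of_mem_smoothPolygonTable (List.get_mem _ i)).isSmoothPolytope⟩

theorem encard_setOf_mem_list {α : Type*} {L : List α} (hL : L.Nodup) :
    {x | x ∈ L}.encard = L.length := by
  classical
  rw [← List.coe_toFinset, Set.encard_coe_eq_coe_finsetCard, List.toFinset_card_of_nodup hL]

theorem numVertices_tablePolygon (i : Fin smoothPolygonTable.length) :
    (tablePolygon i).numVertices = (smoothPolygonTable.get i).corners.length := by
  have h := isValid_of_mem_smoothPolygonTable (List.get_mem smoothPolygonTable i)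
  rw [SmoothPolygon.numVertices, tablePolygon, h.extremePoints_toSet,
    intPoint_injective.encard_image, encard_setOf_mem_list h.nodup_vertices, List.length_map]

theorem numLatticePoints_tablePolygon (i : Fin smoothPolygonTable.length) :
    (tablePolygon i).numLatticePoints ≤ (12 : ℕ) := by
  have h := isValid_of_mem_smoothPolygonTable (List.get_mem smoothPolygonTable i)
  have hlen : ∀ T ∈ smoothPolygonTable, T.pts.length ≤ 12 := by decide +kernel
  rw [SmoothPolygon.numLatticePoints, tablePolygon, ← encard_latticePoints, h.latticePoints_toSet,
    encard_setOf_mem_list h.nodup_pts]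
  exact_mod_cast hlen _ (List.get_mem smoothPolygonTable i)

theorem numVertices_eq_of_equiv {P Q : SmoothPolygon} (h : P ≈ Q) :
    P.numVertices = Q.numVertices :=
  IntegrallyEquivalent.encard_extremePoints_eq h

theorem injective_mk_tablePolygon :
    Function.Injective fun i => (⟦tablePolygon i⟧ : Quotient smoothPolygonSetoid) := by
  intro i j hij
  have h : tablePolygon i ≈ tablePolygon j := Quotient.exact hij
  have h1 := numVertices_eq_of_equiv h
  rw [numVertices_tablePolygon, numVertices_tablePolygon, Nat.cast_inj] at h1
  have h2 := IntegrallyEquivalent.scatterDet_eq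
    (isValid_of_mem_smoothPolygonTable (List.get_mem smoothPolygonTable i))
    (isValid_of_mem_smoothPolygonTable (List.get_mem smoothPolygonTable j)) h
  have h3 := List.inj_on_of_nodup_map nodup_invariants_smoothPolygonTable (List.get_mem _ i)
    (List.get_mem _ j) (Prod.ext h1 h2)
  exact List.nodup_iff_injective_get.1 (List.Nodup.of_map _ nodup_invariants_smoothPolygonTable) h3

theorem exists_tablePolygon_equiv {P : SmoothPolygon} (hP : P.numLatticePoints ≤ (12 : ℕ)) :
    ∃ i, P ≈ tablePolygon i := by
  obtain ⟨T, hT, h⟩ := exists_integrallyEquivalent_of_encard_le P.2.1 P.2.2 hP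
  obtain ⟨i, rfl⟩ := List.get_of_mem hT
  exact ⟨i, h⟩

theorem smoothPolygonClasses_twelve : smoothPolygonClasses 12 =
    (fun i => (⟦tablePolygon i⟧ : Quotient smoothPolygonSetoid)) '' Set.univ := by
  ext c
  constructor
  · rintro ⟨P, hP, rfl⟩
    obtain ⟨i, hi⟩ := exists_tablePolygon_equiv hP
    exact ⟨i, trivial, (Quotient.sound hi).symm⟩
  · rintro ⟨i, -, rfl⟩
    exact ⟨_, numLatticePoints_tablePolygon i, rfl⟩

theorem smoothPolygonClassesWithVertices_twelve (n : ℕ) :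
    smoothPolygonClassesWithVertices 12 n =
      (fun i => (⟦tablePolygon i⟧ : Quotient smoothPolygonSetoid)) ''
        ({i | (smoothPolygonTable.get i).corners.length = n} : Finset _) := by
  ext c
  simp only [Finset.coe_filter, Finset.mem_univ, true_and]
  constructor
  · rintro ⟨P, hP, hn, rfl⟩
    obtain ⟨i, hi⟩ := exists_tablePolygon_equiv hP
    rw [numVertices_eq_of_equiv hi, numVertices_tablePolygon, Nat.cast_inj] at hn
    exact ⟨i, hn, (Quotient.sound hi).symm⟩
  · rintro ⟨i, hi, rfl⟩
    refine ⟨_, numLatticePoints_tablePolygon i, ?_, rfl⟩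
    rw [numVertices_tablePolygon, Nat.cast_inj]
    exact hi

theorem encard_smoothPolygonClassesWithVertices_twelve (n : ℕ) :
    (smoothPolygonClassesWithVertices 12 n).encard =
      (Finset.card {i | (smoothPolygonTable.get i).corners.length = n} : ℕ) := by
  rw [smoothPolygonClassesWithVertices_twelve, injective_mk_tablePolygon.encard_image,
    Set.encard_coe_eq_coe_finsetCard]

theorem mainTheorem9 :
    (smoothPolygonClasses 12).encard = 41 ∧
    (smoothPolygonClassesWithVertices 12 3).encard = 3 ∧
    (smoothPolygonClassesWithVertices 12 4).encard = 30 ∧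
    (smoothPolygonClassesWithVertices 12 5).encard = 3 ∧
    (smoothPolygonClassesWithVertices 12 6).encard = 4 ∧
    (smoothPolygonClassesWithVertices 12 7).encard = 0 ∧
    (smoothPolygonClassesWithVertices 12 8).encard = 1 ∧
    ∀ n : ℕ, 9 ≤ n → (smoothPolygonClassesWithVertices 12 n).encard = 0 := by
  have key : ∀ n m : ℕ,
      Finset.card {i | (smoothPolygonTable.get i).corners.length = n} = m →
      (smoothPolygonClassesWithVertices 12 n).encard = m := fun n m h => by
    rw [encard_smoothPolygonClassesWithVertices_twelve, h]
  refine ⟨?_, key 3 3 (by decide +kernel), key 4 30 (by decide +kernel),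
    key 5 3 (by decide +kernel), key 6 4 (by decide +kernel), key 7 0 (by decide +kernel),
    key 8 1 (by decide +kernel), fun n hn => key n 0 ?_⟩
  · rw [smoothPolygonClasses_twelve, injective_mk_tablePolygon.encard_image, Set.encard_univ,
      ENat.card_eq_coe_fintype_card, Fintype.card_fin]
    rfl
  · have hlen : ∀ i, (smoothPolygonTable.get i).corners.length ≤ 8 := by decide +kernel
    rw [Finset.card_eq_zero, Finset.filter_eq_empty_iff]
    intro i _ hi
    have := hlen i
    omega
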